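/- Let $n\ge 1$ and $-\frac{1}{2n+3}\le s\le 0$. Call a function $f:\mathbb{R}^n\to[0,\infty)$ $s$-concave if for all $x,y\in\mathbb{R}^n$ with $f(x)f(y)>0$ and all $\lambda\in[0,1]$, $$f(\lambda x+(1-\lambda)y)\ \ge\ \left(\lambda f(x)^s+(1-\lambda)f(y)^s\right)^{1/s},$$ where for $s=0$ the right-hand side is replaced by its limit $f(x)^\lambda f(y)^{1-\lambda}$. Let $\mathcal{D}$ be a probability distribution on $\mathbb{R}^n$ that has an $s$-concave density with respect to Lebesgue measure and is isotropic, i.e. has mean $0$ and identity covariance matrix. Put $\gamma=\frac{s}{1+(n-1)s}$ and $$f_3(s,n)=\frac{2(1+ns)}{1+(n+2)s},\qquad d(s,n)=\left(\frac{1+2\gamma}{1+\gamma}\right)^{-\frac{1+\gamma}{\gamma}}\frac{1+3\gamma}{3+3\gamma},$$ $$f_2(s,n)=2\left(2-2^{-2\gamma}\right)^{-1/\gamma}(4e\pi)^{-1/2}\left(2\left(\frac{1+\gamma}{1+3\gamma}\sqrt{3}\left(\frac{1+2\gamma}{1+\gamma}\right)^{\frac{3+3\gamma}{2\gamma}}\right)^{\gamma}-1\right)^{-1/\gamma},$$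 where for $s=0$ the last two expressions stand for their limits as $\gamma\to0$, namely $d(0,n)=\frac{1}{3e}$ and $f_2(0,n)=\frac{1}{2}(4e\pi)^{-1/2}\frac{1}{3e^3}$. Then for every unit vector $w\in\mathbb{R}^n$: 1. for every $t\ge 0$, $\ \Pr_{x\sim\mathcal{D}}[|w\cdot x|\le t]\le f_3(s,n)\,t$; 2. for every $0<t\le d(s,n)$, $\ \Pr_{x\sim\mathcal{D}}[|w\cdot x|\le t]> f_2(s,n)\,t$. -/

import Mathlib

open MeasureTheory ProbabilityTheory

noncomputable section

/-- The weighted power mean of order `s` of `a, b ≥ 0` with weights `l` and `1 - l`: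
`(l a ^ s + (1 - l) b ^ s) ^ (1 / s)` for `s ≠ 0`, its limit `a ^ l b ^ (1 - l)` for `s = 0`,
and, as usual in this context, `0` as soon as `a = 0` or `b = 0`. -/
def powerMean (s l a b : ℝ) : ℝ :=
  if a = 0 ∨ b = 0 then 0
  else if s = 0 then a ^ l * b ^ (1 - l)
  else (l * a ^ s + (1 - l) * b ^ s) ^ (1 / s)

/-- `s`-concavity of a (nonnegative) function on `ℝⁿ`. For `s = 0` this is log-concavity. -/
def SConcave {n : ℕ} (s : ℝ) (f : EuclideanSpace ℝ (Fin n) → ℝ) : Prop :=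
  (∀ x, 0 ≤ f x) ∧
    ∀ x y : EuclideanSpace ℝ (Fin n), ∀ l : ℝ, 0 ≤ l → l ≤ 1 →
      powerMean s l (f x) (f y) ≤ f (l • x + (1 - l) • y)

/-- A distribution on `ℝⁿ` is `s`-concave if it has an `s`-concave density with respect to
Lebesgue measure. -/
def IsSConcaveDistribution {n : ℕ} (s : ℝ) (μ : Measure (EuclideanSpace ℝ (Fin n))) : Prop :=
  ∃ f : EuclideanSpace ℝ (Fin n) → ℝ, Measurable f ∧ SConcave s f ∧
    μ = (volume : Measure (EuclideanSpace ℝ (Fin n))).withDensity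
      (fun x => ENNReal.ofReal (f x))

/-- A distribution on `ℝⁿ` is isotropic if it has finite second moments, mean zero, and the
identity as covariance matrix. -/
def IsIsotropic {n : ℕ} (μ : Measure (EuclideanSpace ℝ (Fin n))) : Prop :=
  MemLp (fun x : EuclideanSpace ℝ (Fin n) => x) 2 μ ∧
    (∫ x, x ∂μ) = 0 ∧
    ∀ i j : Fin n,
      covariance (fun x : EuclideanSpace ℝ (Fin n) => x i)
        (fun x : EuclideanSpace ℝ (Fin n) => x j) μ = (1 : Matrix (Fin n) (Fin n) ℝ) i j

/-- The concavity exponent `γ = s / (1 + (n - 1) s)` of one-dimensional marginals. -/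
def bandGamma (s : ℝ) (n : ℕ) : ℝ := s / (1 + ((n : ℝ) - 1) * s)

/-- The constant `f₃(s, n)` of the upper bound. -/
def bandUpper (s : ℝ) (n : ℕ) : ℝ := 2 * (1 + (n : ℝ) * s) / (1 + ((n : ℝ) + 2) * s)

/-- The constant `d(s, n)`, as a function of `γ`; at `γ = 0` the limit value. -/
def bandRadiusOfGamma (g : ℝ) : ℝ :=
  if g = 0 then Real.exp (-1) / 3
  else ((1 + 2 * g) / (1 + g)) ^ (-((1 + g) / g)) * ((1 + 3 * g) / (3 + 3 * g))

/-- The constant `d(s, n)`: the widths for which the lower bound is claimed. -/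
def bandRadius (s : ℝ) (n : ℕ) : ℝ := bandRadiusOfGamma (bandGamma s n)

/-- The constant `f₂(s, n)`, as a function of `γ`. At `γ = 0` it is the limit value: there
`(2 - 2 ^ (-2γ)) ^ (-1/γ)` tends to `1 / 4`, and `(2 X ^ γ - 1) ^ (-1/γ)` tends to
`(√3 e ^ (3/2)) ^ (-2) = 1 / (3 e ^ 3)`. -/
def bandLowerOfGamma (g : ℝ) : ℝ :=
  if g = 0 then
    2 * (1 / 4) * (4 * Real.exp 1 * Real.pi) ^ (-(1 / 2) : ℝ) * (1 / (3 * Real.exp 3))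
  else
    2 * (2 - (2 : ℝ) ^ (-(2 * g))) ^ (-(1 / g)) *
      (4 * Real.exp 1 * Real.pi) ^ (-(1 / 2) : ℝ) *
      (2 * ((1 + g) / (1 + 3 * g) * √3 *
        ((1 + 2 * g) / (1 + g)) ^ ((3 + 3 * g) / (2 * g))) ^ g - 1) ^ (-(1 / g))

/-- The constant `f₂(s, n)` of the lower bound. -/
def bandLower (s : ℝ) (n : ℕ) : ℝ := bandLowerOfGamma (bandGamma s n)

end

/-!
The proof reduces the claim to one dimension, where the distribution of `⟨w, x⟩` has a density `g`
with mean `0` and variance `1`.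

*Marginals.* Integrating out one real variable turns `s`-concavity into `s / (1 + s)`-concavity
(`BoundedSConcave.marginal`). For functions of one variable that are themselves `s`-concave, all
superlevel sets are intervals, so the Borell–Brascamp–Lieb inequality `powerMean_integral_le`
follows from comparing lengths of intervals, the layer-cake formula and Hölder's inequality for
power means. Iterating over `n - 1` variables gives the exponent `γ = s / (1 + (n - 1) s)`. To have
finite integrals throughout, the density is first truncated in height and to a ball, which preserves
`s`-concavity; the truncation is removed in `exists_bounded_marginal_density`.

*Upper bound.* Write `γ = -u`. On each side of a point `x₀`, a `γ`-concave function is compared with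
Pareto profiles `A (1 + β y) ^ (-1 / u)`, whose power `γ` is affine. Counting sign changes of the
difference bounds the first moment by the mass and the value at `x₀`
(`BoundedSConcave.mul_integral_le`), and the second moment by the mass and the first moment
(`BoundedSConcave.mul_integral_sq_le`). Together they bound the variance by
`((1 - u) / (1 - 3 u)) ^ 2 / g x₀ ^ 2`, so `g ≤ (1 - u) / (1 - 3 u)`, which is half of
`bandUpper s n`.

*Lower bound.* The constant `bandLower s n` is below `1 / 500`, so it is enough that `g > 1 / 1000`
on the band. As `g` is quasi-concave, it suffices to find a point with such a value on each side of
the band. If there were none on one side, the tail there would carry little mass; but by the mean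
being `0` and the bound on `g`, it must carry a substantial first moment, and the two are
incompatible with variance `1` (`exists_large_value_right`).

*The case `s = 0`.* A log-concave function is `s`-concave for all `s < 0`. The upper bound follows
by letting `s` tend to `0`, and the lower bound has room for a small negative `s`.
-/

/-! ### Power means of negative order -/

theorem powerMean_of_pos {s l a b : ℝ} (hs : s < 0) (ha : 0 < a) (hb : 0 < b) :
    powerMean s l a b = (l * a ^ s + (1 - l) * b ^ s) ^ (1 / s) := by
  simp [powerMean, ha.ne', hb.ne', hs.ne]

theorem powerMean_eq_zero {s l a b : ℝ} (h : a = 0 ∨ b = 0) : powerMean s l a b = 0 := by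
  simp [powerMean, h]

theorem weighted_sum_pos {l a b : ℝ} (hl : 0 ≤ l) (hl1 : l ≤ 1) (ha : 0 < a) (hb : 0 < b) :
    0 < l * a + (1 - l) * b := by
  rcases hl.eq_or_lt with rfl | hl
  · simpa using hb
  · have := mul_pos hl ha
    have := mul_nonneg (sub_nonneg.2 hl1) hb.le
    linarith

theorem powerMean_nonneg {s l a b : ℝ} (hs : s < 0) (hl : 0 ≤ l) (hl1 : l ≤ 1) (ha : 0 ≤ a)
    (hb : 0 ≤ b) : 0 ≤ powerMean s l a b := by
  rcases ha.eq_or_lt with rfl | ha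
  · simp [powerMean]
  rcases hb.eq_or_lt with rfl | hb
  · simp [powerMean]
  rw [powerMean_of_pos hs ha hb]
  exact Real.rpow_nonneg (weighted_sum_pos hl hl1 (Real.rpow_pos_of_pos ha _)
    (Real.rpow_pos_of_pos hb _)).le _

theorem powerMean_pos {s l a b : ℝ} (hs : s < 0) (hl : 0 ≤ l) (hl1 : l ≤ 1) (ha : 0 < a)
    (hb : 0 < b) : 0 < powerMean s l a b := by
  rw [powerMean_of_pos hs ha hb]
  exact Real.rpow_pos_of_pos (weighted_sum_pos hl hl1 (Real.rpow_pos_of_pos ha _)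
    (Real.rpow_pos_of_pos hb _)) _

theorem powerMean_mono {s l a b a' b' : ℝ} (hs : s < 0) (hl : 0 ≤ l) (hl1 : l ≤ 1) (ha : 0 ≤ a)
    (hb : 0 ≤ b) (haa : a ≤ a') (hbb : b ≤ b') : powerMean s l a b ≤ powerMean s l a' b' := by
  rcases ha.eq_or_lt with rfl | ha
  · rw [powerMean_eq_zero (Or.inl rfl)]
    exact powerMean_nonneg hs hl hl1 haa (hb.trans hbb)
  rcases hb.eq_or_lt with rfl | hb
  · rw [powerMean_eq_zero (Or.inr rfl)]
    exact powerMean_nonneg hs hl hl1 (ha.le.trans haa) hbb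
  have ha' := ha.trans_le haa
  have hb' := hb.trans_le hbb
  rw [powerMean_of_pos hs ha hb, powerMean_of_pos hs ha' hb']
  apply Real.rpow_le_rpow_of_nonpos
  · exact weighted_sum_pos hl hl1 (Real.rpow_pos_of_pos ha' _) (Real.rpow_pos_of_pos hb' _)
  · have h1 := Real.rpow_le_rpow_of_nonpos ha haa hs.le
    have h2 := Real.rpow_le_rpow_of_nonpos hb hbb hs.le
    have := sub_nonneg.2 hl1
    gcongr
  · exact (one_div_neg.2 hs).le

theorem powerMean_smul {s l a b c : ℝ} (hs : s < 0) (hl : 0 ≤ l) (hl1 : l ≤ 1) (ha : 0 < a)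
    (hb : 0 < b) (hc : 0 < c) : powerMean s l (c * a) (c * b) = c * powerMean s l a b := by
  rw [powerMean_of_pos hs (mul_pos hc ha) (mul_pos hc hb), powerMean_of_pos hs ha hb,
    Real.mul_rpow hc.le ha.le, Real.mul_rpow hc.le hb.le]
  have h : l * (c ^ s * a ^ s) + (1 - l) * (c ^ s * b ^ s) =
      c ^ s * (l * a ^ s + (1 - l) * b ^ s) := by ring
  rw [h, Real.mul_rpow (Real.rpow_nonneg hc.le _)
    (weighted_sum_pos hl hl1 (Real.rpow_pos_of_pos ha _) (Real.rpow_pos_of_pos hb _)).le,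
    ← Real.rpow_mul hc.le, mul_one_div_cancel hs.ne, Real.rpow_one]

theorem powerMean_self {s l a : ℝ} (hs : s < 0) (ha : 0 ≤ a) : powerMean s l a a = a := by
  rcases ha.eq_or_lt with rfl | ha
  · simp [powerMean]
  rw [powerMean_of_pos hs ha ha, ← add_mul, add_sub_cancel, one_mul, ← Real.rpow_mul ha.le,
    mul_one_div_cancel hs.ne, Real.rpow_one]

theorem min_le_powerMean {s l a b : ℝ} (hs : s < 0) (hl : 0 ≤ l) (hl1 : l ≤ 1) (ha : 0 ≤ a)
    (hb : 0 ≤ b) : min a b ≤ powerMean s l a b := by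
  have h0 : 0 ≤ min a b := le_min ha hb
  calc min a b = powerMean s l (min a b) (min a b) := (powerMean_self hs h0).symm
    _ ≤ _ := powerMean_mono hs hl hl1 h0 h0 (min_le_left _ _) (min_le_right _ _)

theorem powerMean_le_powerMean_zero {s l a b : ℝ} (hs : s < 0) (hl : 0 ≤ l) (hl1 : l ≤ 1)
    (ha : 0 ≤ a) (hb : 0 ≤ b) : powerMean s l a b ≤ powerMean 0 l a b := by
  rcases ha.eq_or_lt with rfl | ha
  · simp [powerMean]
  rcases hb.eq_or_lt with rfl | hb
  · simp [powerMean]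
  rw [powerMean_of_pos hs ha hb]
  simp only [powerMean, ha.ne', hb.ne', or_self, if_false, if_true]
  have h := Real.geom_mean_le_arith_mean2_weighted hl (sub_nonneg.2 hl1)
    (Real.rpow_nonneg ha.le s) (Real.rpow_nonneg hb.le s) (by ring)
  have hp : 0 < (a ^ s) ^ l * (b ^ s) ^ (1 - l) := by positivity
  refine (Real.rpow_le_rpow_of_nonpos hp h (one_div_neg.2 hs).le).trans_eq ?_
  rw [Real.mul_rpow (by positivity) (by positivity), ← Real.rpow_mul ha.le, ← Real.rpow_mul ha.le,
    ← Real.rpow_mul hb.le, ← Real.rpow_mul hb.le]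
  congr 2 <;> field_simp [hs.ne]

/-- Hölder's inequality for power means: the mean of order `s` times the arithmetic mean
dominates the mean of order `s / (1 + s)` of the products. -/
theorem powerMean_le_powerMean_mul {s l A B a b : ℝ} (hs : s < 0) (hs1 : -1 < s) (hl : 0 ≤ l)
    (hl1 : l ≤ 1) (hA : 0 < A) (hB : 0 < B) (ha : 0 < a) (hb : 0 < b) :
    powerMean (s / (1 + s)) l (A * a) (B * b) ≤
      powerMean s l A B * (l * a + (1 - l) * b) := by
  have h1s : 0 < 1 + s := by linarith
  have hs' : s / (1 + s) < 0 := div_neg_of_neg_of_pos hs h1s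
  have hAa := mul_pos hA ha
  have hBb := mul_pos hB hb
  rw [powerMean_of_pos hs' hAa hBb, powerMean_of_pos hs hA hB]
  set X := l * (A * a) ^ (s / (1 + s)) + (1 - l) * (B * b) ^ (s / (1 + s)) with hX
  set Y := l * a + (1 - l) * b with hY
  have hXp : 0 < X := weighted_sum_pos hl hl1 (Real.rpow_pos_of_pos hAa _)
    (Real.rpow_pos_of_pos hBb _)
  have hYp : 0 < Y := weighted_sum_pos hl hl1 ha hb
  have key : ∀ C c : ℝ, 0 < C → 0 < c → C ^ s / (X ^ (1 + s) * Y ^ (-s)) ≤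
      (1 + s) * ((C * c) ^ (s / (1 + s)) / X) + (-s) * (c / Y) := by
    intro C c hC hc
    have hCc := mul_pos hC hc
    have h := Real.geom_mean_le_arith_mean2_weighted h1s.le (neg_nonneg.2 hs.le)
      (p₁ := (C * c) ^ (s / (1 + s)) / X) (p₂ := c / Y) (by positivity) (by positivity) (by ring)
    refine le_trans (le_of_eq ?_) h
    rw [Real.div_rpow (by positivity) hXp.le, Real.div_rpow hc.le hYp.le,
      ← Real.rpow_mul hCc.le, div_mul_cancel₀ _ h1s.ne', Real.mul_rpow hC.le hc.le, div_mul_div_comm,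
      mul_assoc, ← Real.rpow_add hc]
    simp
  have hle : l * A ^ s + (1 - l) * B ^ s ≤ X ^ (1 + s) * Y ^ (-s) := by
    have hD : 0 < X ^ (1 + s) * Y ^ (-s) := by positivity
    rw [← div_le_one hD]
    have h1 := mul_le_mul_of_nonneg_left (key A a hA ha) hl
    have h2 := mul_le_mul_of_nonneg_left (key B b hB hb) (sub_nonneg.2 hl1)
    have e : l * ((1 + s) * ((A * a) ^ (s / (1 + s)) / X) + (-s) * (a / Y)) +
        (1 - l) * ((1 + s) * ((B * b) ^ (s / (1 + s)) / X) + (-s) * (b / Y)) =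
        (1 + s) * (X / X) + (-s) * (Y / Y) := by
      simp only [hX, hY]; ring
    rw [div_self hXp.ne', div_self hYp.ne'] at e
    calc _ = l * (A ^ s / (X ^ (1 + s) * Y ^ (-s))) +
        (1 - l) * (B ^ s / (X ^ (1 + s) * Y ^ (-s))) := by ring
      _ ≤ _ := by linarith
  have hpos : 0 < l * A ^ s + (1 - l) * B ^ s :=
    weighted_sum_pos hl hl1 (Real.rpow_pos_of_pos hA _) (Real.rpow_pos_of_pos hB _)
  have h := Real.rpow_le_rpow_of_nonpos hpos hle (one_div_neg.2 hs).le
  rw [Real.mul_rpow (by positivity) (by positivity), ← Real.rpow_mul hXp.le,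
    ← Real.rpow_mul hYp.le] at h
  have e1 : (1 + s) * (1 / s) = 1 / (s / (1 + s)) := by field_simp
  have e2 : -s * (1 / s) = -1 := by field_simp [hs.ne]
  rw [e1, e2] at h
  have h3 := mul_le_mul_of_nonneg_right h hYp.le
  rwa [Real.rpow_neg_one, mul_assoc, inv_mul_cancel₀ hYp.ne', mul_one] at h3

/-! ### Marginals of `s`-concave functions -/

/-- A bounded measurable `s`-concave function with bounded support on a normed space. These
functions have finite integrals along all fibres, so that marginals can be taken freely. -/
structure BoundedSConcave {E : Type*} [NormedAddCommGroup E] [NormedSpace ℝ E]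
    [MeasurableSpace E] (s : ℝ) (f : E → ℝ) : Prop where
  measurable : Measurable f
  nonneg : ∀ x, 0 ≤ f x
  bounded : ∃ B, ∀ x, f x ≤ B
  support : ∃ R, ∀ x, f x ≠ 0 → ‖x‖ ≤ R
  concave : ∀ x y : E, ∀ l : ℝ, 0 ≤ l → l ≤ 1 →
    powerMean s l (f x) (f y) ≤ f (l • x + (1 - l) • y)

namespace BoundedSConcave

variable {E E' : Type*} [NormedAddCommGroup E] [NormedSpace ℝ E] [MeasurableSpace E]
  [NormedAddCommGroup E'] [NormedSpace ℝ E'] [MeasurableSpace E'] {s : ℝ} {f : E → ℝ}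

theorem comp_affine (hf : BoundedSConcave s f) {g : E' → E} (hg : Measurable g) (K : ℝ)
    (hK : ∀ x, ‖x‖ ≤ ‖g x‖ + K)
    (haff : ∀ x y : E', ∀ l : ℝ, g (l • x + (1 - l) • y) = l • g x + (1 - l) • g y) :
    BoundedSConcave s (fun x => f (g x)) where
  measurable := hf.measurable.comp hg
  nonneg x := hf.nonneg _
  bounded := hf.bounded.imp fun B hB x => hB _
  support := by
    obtain ⟨R, hR⟩ := hf.support
    exact ⟨R + K, fun x hx => (hK x).trans (by linarith [hR _ hx])⟩
  concave x y l hl hl1 := by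
    rw [haff]
    exact hf.concave _ _ l hl hl1

theorem integrable [ProperSpace E] [OpensMeasurableSpace E] (hf : BoundedSConcave s f)
    (μ : Measure E) [IsFiniteMeasureOnCompacts μ] : Integrable f μ := by
  obtain ⟨B, hB⟩ := hf.bounded
  obtain ⟨R, hR⟩ := hf.support
  have hsub : Function.support f ⊆ Metric.closedBall 0 R := fun x hx => by
    simpa using hR x hx
  rw [← integrableOn_iff_integrable_of_support_subset hsub]
  refine Measure.integrableOn_of_bounded (M := B) ?_ hf.measurable.aestronglyMeasurable ?_
  · exact (isCompact_closedBall 0 R).measure_lt_top.ne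
  · exact Filter.Eventually.of_forall fun x => by
      rw [Real.norm_of_nonneg (hf.nonneg x)]; exact hB x

theorem min_le (hs : s < 0) (hf : BoundedSConcave s f) (x y : E) {l : ℝ} (hl : 0 ≤ l)
    (hl1 : l ≤ 1) : min (f x) (f y) ≤ f (l • x + (1 - l) • y) :=
  (min_le_powerMean hs hl hl1 (hf.nonneg x) (hf.nonneg y)).trans (hf.concave x y l hl hl1)

/-- An `s`-concave function on the line is quasi-concave. -/
theorem min_le_of_mem_Icc {h : ℝ → ℝ} (hs : s < 0) (hh : BoundedSConcave s h) {x y z : ℝ}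
    (hxy : x ≤ y) (hyz : y ≤ z) : min (h x) (h z) ≤ h y := by
  rcases (hxy.trans hyz).eq_or_lt with rfl | hlt
  · obtain rfl := le_antisymm hxy hyz
    simp
  have hd : 0 < z - x := sub_pos.2 hlt
  have h1 := hh.min_le hs x z (l := (z - y) / (z - x)) (div_nonneg (by linarith) hd.le)
    ((div_le_one hd).2 (by linarith))
  have e : ((z - y) / (z - x)) • x + (1 - (z - y) / (z - x)) • z = y := by
    simp only [smul_eq_mul]
    field_simp
    ring
  rwa [e] at h1

end BoundedSConcave

/-- The one-dimensional Brunn–Minkowski inequality, for an interval containing the combination. -/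
theorem length_combination_le {S T U : Set ℝ} {l : ℝ} (hl : 0 ≤ l) (hl1 : l ≤ 1)
    (hS : S.Nonempty) (hT : T.Nonempty) (hSb : Bornology.IsBounded S)
    (hTb : Bornology.IsBounded T) (hUb : Bornology.IsBounded U) (hU : U.OrdConnected)
    (h : ∀ x ∈ S, ∀ y ∈ T, l * x + (1 - l) * y ∈ U) :
    ENNReal.ofReal l * volume S + ENNReal.ofReal (1 - l) * volume T ≤ volume U := by
  have h1l := sub_nonneg.2 hl1
  have hlen : ∀ S : Set ℝ, Bornology.IsBounded S → volume S ≤ ENNReal.ofReal (sSup S - sInf S) := by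
    intro S hSb
    rw [← Real.volume_Icc]
    exact measure_mono fun x hx => ⟨csInf_le hSb.bddBelow hx, le_csSup hSb.bddAbove hx⟩
  have hI : sInf U ≤ l * sInf S + (1 - l) * sInf T := by
    have h1 : ∀ x ∈ S, sInf U - l * x ≤ (1 - l) * sInf T := fun x hx => by
      rw [← smul_eq_mul (1 - l), ← Real.sInf_smul_of_nonneg h1l]
      refine le_csInf hT.smul_set ?_
      rintro _ ⟨y, hy, rfl⟩
      have := csInf_le hUb.bddBelow (h x hx y hy)
      simp only [smul_eq_mul]; linarith
    have h2 : sInf U - (1 - l) * sInf T ≤ l * sInf S := by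
      rw [← smul_eq_mul l, ← Real.sInf_smul_of_nonneg hl]
      refine le_csInf hS.smul_set ?_
      rintro _ ⟨x, hx, rfl⟩
      have := h1 x hx
      simp only [smul_eq_mul]; linarith
    linarith
  have hJ : l * sSup S + (1 - l) * sSup T ≤ sSup U := by
    have h1 : ∀ x ∈ S, (1 - l) * sSup T ≤ sSup U - l * x := fun x hx => by
      rw [← smul_eq_mul (1 - l), ← Real.sSup_smul_of_nonneg h1l]
      refine csSup_le hT.smul_set ?_
      rintro _ ⟨y, hy, rfl⟩
      have := le_csSup hUb.bddAbove (h x hx y hy)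
      simp only [smul_eq_mul]; linarith
    have h2 : l * sSup S ≤ sSup U - (1 - l) * sSup T := by
      rw [← smul_eq_mul l, ← Real.sSup_smul_of_nonneg hl]
      refine csSup_le hS.smul_set ?_
      rintro _ ⟨x, hx, rfl⟩
      have := h1 x hx
      simp only [smul_eq_mul]; linarith
    linarith
  have hSd : 0 ≤ sSup S - sInf S := sub_nonneg.2 (Real.sInf_le_sSup _ hSb.bddBelow hSb.bddAbove)
  have hTd : 0 ≤ sSup T - sInf T := sub_nonneg.2 (Real.sInf_le_sSup _ hTb.bddBelow hTb.bddAbove)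
  have hUne : U.Nonempty := by
    obtain ⟨x, hx⟩ := hS
    obtain ⟨y, hy⟩ := hT
    exact ⟨_, h x hx y hy⟩
  calc ENNReal.ofReal l * volume S + ENNReal.ofReal (1 - l) * volume T
      ≤ ENNReal.ofReal l * ENNReal.ofReal (sSup S - sInf S) +
        ENNReal.ofReal (1 - l) * ENNReal.ofReal (sSup T - sInf T) := by
        gcongr
        · exact hlen S hSb
        · exact hlen T hTb
    _ = ENNReal.ofReal (l * (sSup S - sInf S) + (1 - l) * (sSup T - sInf T)) := by
        rw [← ENNReal.ofReal_mul hl, ← ENNReal.ofReal_mul h1l, ENNReal.ofReal_add] <;> positivity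
    _ ≤ ENNReal.ofReal (sSup U - sInf U) := ENNReal.ofReal_le_ofReal (by linarith)
    _ = volume (Set.Ioo (sInf U) (sSup U)) := (Real.volume_Ioo).symm
    _ ≤ volume U := by
        refine measure_mono fun x hx => ?_
        obtain ⟨a, ha, hax⟩ := exists_lt_of_csInf_lt hUne hx.1
        obtain ⟨b, hb, hxb⟩ := exists_lt_of_lt_csSup hUne hx.2
        exact hU.out ha hb ⟨hax.le, hxb.le⟩

/-- The one-dimensional Borell–Brascamp–Lieb inequality. The superlevel sets of the functions,
each divided by its supremum, are intervals satisfying the Brunn–Minkowski inequality; integrating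
over the levels bounds `∫ f₂` from below by an arithmetic mean, and Hölder's inequality for power
means concludes. -/
theorem powerMean_integral_le {s l : ℝ} (hs : s < 0) (hs1 : -1 < s) (hl : 0 ≤ l) (hl1 : l ≤ 1)
    {f₀ f₁ f₂ : ℝ → ℝ} (h₀ : BoundedSConcave s f₀) (h₁ : BoundedSConcave s f₁)
    (h₂ : BoundedSConcave s f₂)
    (h : ∀ x y, powerMean s l (f₀ x) (f₁ y) ≤ f₂ (l * x + (1 - l) * y)) :
    powerMean (s / (1 + s)) l (∫ x, f₀ x) (∫ x, f₁ x) ≤ ∫ x, f₂ x := by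
  have h1l := sub_nonneg.2 hl1
  have i₀ := h₀.integrable volume
  have i₁ := h₁.integrable volume
  have i₂ := h₂.integrable volume
  have n₀ : 0 ≤ ∫ x, f₀ x := integral_nonneg h₀.nonneg
  have n₁ : 0 ≤ ∫ x, f₁ x := integral_nonneg h₁.nonneg
  have n₂ : 0 ≤ ∫ x, f₂ x := integral_nonneg h₂.nonneg
  rcases n₀.eq_or_lt with e | p₀
  · rwa [powerMean_eq_zero (Or.inl e.symm)]
  rcases n₁.eq_or_lt with e | p₁
  · rwa [powerMean_eq_zero (Or.inr e.symm)]
  have hsup : ∀ f : ℝ → ℝ, BoundedSConcave s f → 0 < ∫ x, f x →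
      BddAbove (Set.range f) ∧ 0 < sSup (Set.range f) := by
    intro f hf hp
    obtain ⟨B, hB⟩ := hf.bounded
    have hb : BddAbove (Set.range f) := ⟨B, by rintro _ ⟨x, rfl⟩; exact hB x⟩
    refine ⟨hb, ?_⟩
    by_contra hcon
    have : ∀ x, f x = 0 := fun x =>
      le_antisymm ((le_csSup hb ⟨x, rfl⟩).trans (not_lt.1 hcon)) (hf.nonneg x)
    simp [this] at hp
  obtain ⟨b₀, hA⟩ := hsup f₀ h₀ p₀
  obtain ⟨b₁, hB⟩ := hsup f₁ h₁ p₁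
  set A := sSup (Set.range f₀)
  set B := sSup (Set.range f₁)
  set N := powerMean s l A B with hNdef
  have hN : 0 < N := powerMean_pos hs hl hl1 hA hB
  have hbdd : ∀ (f : ℝ → ℝ) (c : ℝ), BoundedSConcave s f → 0 < c →
      Bornology.IsBounded {x | c < f x} ∧ Bornology.IsBounded {x | c ≤ f x} := by
    intro f c hf hc
    obtain ⟨R, hR⟩ := hf.support
    constructor
    · refine (Metric.isBounded_closedBall (x := (0 : ℝ)) (r := R)).subset fun x hx => ?_
      simpa using hR x (hc.trans hx).ne'
    · refine (Metric.isBounded_closedBall (x := (0 : ℝ)) (r := R)).subset fun x hx => ?_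
      simpa using hR x (hc.trans_le hx).ne'
  have hlevel : ∀ τ ∈ Set.Ioi (0 : ℝ),
      ENNReal.ofReal l * volume {x | τ < f₀ x / A} +
        ENNReal.ofReal (1 - l) * volume {x | τ < f₁ x / B} ≤ volume {x | τ ≤ f₂ x / N} := by
    intro τ hτ
    have hτ : 0 < τ := hτ
    simp only [lt_div_iff₀ hA, lt_div_iff₀ hB, le_div_iff₀ hN]
    rcases lt_or_ge τ 1 with hτ1 | hτ1
    · have hne : ∀ f : ℝ → ℝ, 0 < sSup (Set.range f) →
          {x | τ * sSup (Set.range f) < f x}.Nonempty := by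
        intro f hf
        obtain ⟨_, ⟨x, rfl⟩, hx⟩ := exists_lt_of_lt_csSup (Set.range_nonempty f)
          (mul_lt_of_lt_one_left hf hτ1)
        exact ⟨x, hx⟩
      refine length_combination_le hl hl1 (hne f₀ hA) (hne f₁ hB) (hbdd f₀ _ h₀ (by positivity)).1
        (hbdd f₁ _ h₁ (by positivity)).1 (hbdd f₂ _ h₂ (by positivity)).2 ?_ ?_
      · refine ⟨fun x hx y hy z hz => ?_⟩
        exact (le_min hx hy).trans (h₂.min_le_of_mem_Icc hs hz.1 hz.2)
      · intro x hx y hy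
        refine le_trans ?_ (h x y)
        rw [hNdef, ← powerMean_smul hs hl hl1 hA hB hτ]
        exact powerMean_mono hs hl hl1 (by positivity) (by positivity) (le_of_lt hx) (le_of_lt hy)
    · have he : ∀ f : ℝ → ℝ, BddAbove (Set.range f) → 0 < sSup (Set.range f) →
          {x | τ * sSup (Set.range f) < f x} = ∅ := by
        intro f hb hf
        ext x
        simp only [Set.mem_ofPred_eq, Set.mem_empty_iff_false, iff_false, not_lt]
        exact (le_csSup hb ⟨x, rfl⟩).trans (le_mul_of_one_le_left hf.le hτ1)
      rw [he f₀ b₀ hA, he f₁ b₁ hB]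
      simp
  have hkey : l * ((∫ x, f₀ x) / A) + (1 - l) * ((∫ x, f₁ x) / B) ≤ (∫ x, f₂ x) / N := by
    have hlint : ∀ (f : ℝ → ℝ) (c : ℝ), BoundedSConcave s f → 0 < c →
        ENNReal.ofReal ((∫ x, f x) / c) = ∫⁻ x, ENNReal.ofReal (f x / c) := by
      intro f c hf hc
      rw [← integral_div, ofReal_integral_eq_lintegral_ofReal ((hf.integrable volume).div_const c)]
      exact Filter.Eventually.of_forall fun x => div_nonneg (hf.nonneg x) hc.le
    have hlt : ∀ (f : ℝ → ℝ) (c : ℝ), BoundedSConcave s f → 0 < c →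
        ∫⁻ x, ENNReal.ofReal (f x / c) = ∫⁻ τ in Set.Ioi 0, volume {x | τ < f x / c} :=
      fun f c hf hc => lintegral_eq_lintegral_meas_lt _
        (Filter.Eventually.of_forall fun x => div_nonneg (hf.nonneg x) hc.le)
        (hf.measurable.div_const c).aemeasurable
    have hle : ∫⁻ x, ENNReal.ofReal (f₂ x / N) = ∫⁻ τ in Set.Ioi 0, volume {x | τ ≤ f₂ x / N} :=
      lintegral_eq_lintegral_meas_le _
        (Filter.Eventually.of_forall fun x => div_nonneg (h₂.nonneg x) hN.le)
        (h₂.measurable.div_const N).aemeasurable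
    rw [← ENNReal.ofReal_le_ofReal_iff (by positivity), ENNReal.ofReal_add (by positivity)
      (by positivity), ENNReal.ofReal_mul hl, ENNReal.ofReal_mul h1l, hlint f₀ A h₀ hA,
      hlint f₁ B h₁ hB, hlint f₂ N h₂ hN, hlt f₀ A h₀ hA, hlt f₁ B h₁ hB, hle,
      ← lintegral_const_mul' _ _ ENNReal.ofReal_ne_top,
      ← lintegral_const_mul' _ _ ENNReal.ofReal_ne_top]
    exact (le_lintegral_add _ _).trans (setLIntegral_mono' measurableSet_Ioi hlevel)
  have hH := powerMean_le_powerMean_mul hs hs1 hl hl1 hA hB (div_pos p₀ hA) (div_pos p₁ hB)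
  rw [mul_div_cancel₀ _ hA.ne', mul_div_cancel₀ _ hB.ne'] at hH
  refine hH.trans ?_
  calc _ ≤ N * ((∫ x, f₂ x) / N) := mul_le_mul_of_nonneg_left hkey hN.le
    _ = _ := mul_div_cancel₀ _ hN.ne'

namespace BoundedSConcave

variable {V : Type} [NormedAddCommGroup V] [NormedSpace ℝ V] [MeasurableSpace V]

theorem fibre {s : ℝ} {W : Type*} [NormedAddCommGroup W] [NormedSpace ℝ W] [MeasurableSpace W]
    {f : V × W → ℝ} (hf : BoundedSConcave s f) (v : V) : BoundedSConcave s fun t => f (v, t) := by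
  refine hf.comp_affine (g := fun t => (v, t)) measurable_prodMk_left 0 (fun t => ?_)
    fun x y l => ?_
  · simp [Prod.norm_def]
  · rw [Prod.smul_mk, Prod.smul_mk, Prod.mk_add_mk, ← add_smul, add_sub_cancel, one_smul]

theorem exists_integral_le {s : ℝ} {f : V × ℝ → ℝ} (hf : BoundedSConcave s f) :
    ∃ B, ∀ v, ∫ t, f (v, t) ≤ B := by
  obtain ⟨B, hB⟩ := hf.bounded
  obtain ⟨R, hR⟩ := hf.support
  refine ⟨∫ t in Set.Icc (-R) R, B, fun v => ?_⟩
  have hi := (hf.fibre v).integrable volume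
  have hsub : ∀ t, t ∉ Set.Icc (-R) R → f (v, t) = 0 := by
    intro t ht
    by_contra hne
    have h1 : ‖t‖ ≤ R := (le_max_right _ _).trans (hR _ hne)
    exact ht (abs_le.1 h1)
  rw [← setIntegral_eq_integral_of_forall_compl_eq_zero hsub]
  exact integral_mono hi.integrableOn (integrable_const _) fun t => hB _

/-- Integrating out one real variable turns `s`-concavity into `s / (1 + s)`-concavity. -/
theorem marginal {s : ℝ} {f : V × ℝ → ℝ} (hs : s < 0) (hs1 : -1 < s)
    (hf : BoundedSConcave s f) : BoundedSConcave (s / (1 + s)) fun v => ∫ t, f (v, t) where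
  measurable := hf.measurable.stronglyMeasurable.integral_prod_right'.measurable
  nonneg v := integral_nonneg fun t => hf.nonneg _
  bounded := hf.exists_integral_le
  support := by
    obtain ⟨R, hR⟩ := hf.support
    refine ⟨R, fun v hv => ?_⟩
    by_contra hcon
    refine hv (integral_eq_zero_of_ae (Filter.Eventually.of_forall fun t => ?_))
    by_contra hne
    exact hcon ((le_max_left _ _).trans (hR (v, t) hne))
  concave v w l hl hl1 := by
    refine powerMean_integral_le hs hs1 hl hl1 (hf.fibre v) (hf.fibre w) (hf.fibre _) ?_
    intro x y
    exact hf.concave (v, x) (w, y) l hl hl1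

/-- Integrating out `k` real variables turns `s`-concavity into `s / (1 + k s)`-concavity. -/
theorem marginal_pi (k : ℕ) : ∀ {V : Type} [NormedAddCommGroup V] [NormedSpace ℝ V]
    [MeasurableSpace V] {s : ℝ} {f : V × (Fin k → ℝ) → ℝ}, s < 0 → 0 < 1 + (k : ℝ) * s →
    BoundedSConcave s f → BoundedSConcave (s / (1 + k * s)) fun v => ∫ y, f (v, y) := by
  induction k with
  | zero =>
    intro V _ _ _ s f hs _ hf
    have e : ∀ v, ∫ y, f (v, y) = f (v, 0) := fun v => by
      rw [volume_pi, Measure.pi_of_empty (x := 0), integral_dirac]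
    simp only [e, Nat.cast_zero, zero_mul, add_zero, div_one]
    refine hf.comp_affine (g := fun v => (v, 0)) measurable_prodMk_right 0 (fun t => ?_)
      fun x y l => ?_
    · simp [Prod.norm_def]
    · simp
  | succ k ih =>
    intro V _ _ _ s f hs hk hf
    push_cast at hk ⊢
    have hk0 : (0 : ℝ) ≤ k := Nat.cast_nonneg k
    have hk1 : 0 < 1 + (k : ℝ) * s := by nlinarith
    let e := MeasurableEquiv.piFinSuccAbove (fun _ : Fin (k + 1) => ℝ) 0
    have hfun : BoundedSConcave s
        fun p : (V × ℝ) × (Fin k → ℝ) => f (p.1.1, e.symm (p.1.2, p.2)) := by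
      refine hf.comp_affine
        (g := fun p : (V × ℝ) × (Fin k → ℝ) => (p.1.1, e.symm (p.1.2, p.2))) ?_ 0 ?_ ?_
      · exact (measurable_fst.comp measurable_fst).prodMk
          (e.symm.measurable.comp ((measurable_snd.comp measurable_fst).prodMk measurable_snd))
      · rintro ⟨⟨v, a⟩, y⟩
        simp only [Prod.norm_def, add_zero]
        refine max_le (max_le (le_max_left _ _) ?_) ?_
        · refine le_trans ?_ (le_max_right _ _)
          exact norm_le_pi_norm (e.symm (a, y)) 0
        · refine le_trans ?_ (le_max_right _ _)
          refine (pi_norm_le_iff_of_nonneg (norm_nonneg _)).2 fun i => ?_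
          exact norm_le_pi_norm (e.symm (a, y)) i.succ
      · rintro ⟨⟨v, a⟩, y⟩ ⟨⟨w, b⟩, z⟩ l
        refine Prod.ext rfl ?_
        funext i
        refine Fin.cases ?_ (fun i => ?_) i <;> rfl
    have h1 := ih hs hk1 hfun
    have hs' : s / (1 + k * s) < 0 := div_neg_of_neg_of_pos hs hk1
    have hs1' : -1 < s / (1 + k * s) := by
      rw [lt_div_iff₀ hk1]; linarith
    have h2 := h1.marginal hs' hs1'
    have e1 : s / (1 + k * s) / (1 + s / (1 + k * s)) = s / (1 + ((k : ℝ) + 1) * s) := by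
      have : (1 + k * s) * (1 + s / (1 + k * s)) = 1 + ((k : ℝ) + 1) * s := by
        field_simp; ring
      rw [div_div, this]
    rw [e1] at h2
    convert h2 using 2 with v
    have hmp := (volume_preserving_piFinSuccAbove (fun _ : Fin (k + 1) => ℝ) 0).symm
    rw [← hmp.integral_comp e.symm.measurableEmbedding (fun y => f (v, y))]
    have hi : BoundedSConcave s fun p : ℝ × (Fin k → ℝ) => f (v, e.symm p) := by
      refine hfun.comp_affine (g := fun p : ℝ × (Fin k → ℝ) => ((v, p.1), p.2)) ?_ 0 ?_ ?_
      · fun_prop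
      · rintro ⟨a, y⟩
        simp only [Prod.norm_def, add_zero]
        exact max_le ((le_max_right _ _).trans (le_max_left _ _)) (le_max_right _ _)
      · rintro ⟨a, y⟩ ⟨b, z⟩ l
        simp only [Prod.smul_mk, Prod.mk_add_mk, ← add_smul, add_sub_cancel, one_smul]
    exact integral_prod (fun p => f (v, e.symm p)) (hi.integrable (volume.prod volume))

end BoundedSConcave

/-! ### Comparison with Pareto profiles -/

/-- The Pareto profile `A (1 + β y) ^ (-1 / u)`, whose power `-u` is affine in `y`: it is the
extremal `(-u)`-concave function on the half-line. -/
noncomputable def paretoProfile (u A β y : ℝ) : ℝ := A * (1 + β * y) ^ (-(1 / u))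

theorem paretoProfile_pos {u A β y : ℝ} (hA : 0 < A) (hβ : 0 < β) (hy : 0 ≤ y) :
    0 < paretoProfile u A β y := by
  have : 0 < 1 + β * y := by positivity
  unfold paretoProfile
  positivity

theorem powerMean_paretoProfile {u A β l y z : ℝ} (hu : 0 < u) (hA : 0 < A) (hβ : 0 < β)
    (hl : 0 ≤ l) (hl1 : l ≤ 1) (hy : 0 ≤ y) (hz : 0 ≤ z) :
    powerMean (-u) l (paretoProfile u A β y) (paretoProfile u A β z) =
      paretoProfile u A β (l * y + (1 - l) * z) := by
  have h1l := sub_nonneg.2 hl1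
  have hy' : 0 < 1 + β * y := by positivity
  have hz' : 0 < 1 + β * z := by positivity
  have hc : 0 < 1 + β * (l * y + (1 - l) * z) := by positivity
  have key : ∀ w : ℝ, 0 < w → (A * w ^ (-(1 / u))) ^ (-u) = A ^ (-u) * w := by
    intro w hw
    rw [Real.mul_rpow hA.le (by positivity), ← Real.rpow_mul hw.le]
    have : -(1 / u) * -u = 1 := by field_simp
    rw [this, Real.rpow_one]
  rw [powerMean_of_pos (neg_lt_zero.2 hu) (paretoProfile_pos hA hβ hy)
    (paretoProfile_pos hA hβ hz)]
  unfold paretoProfile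
  rw [key _ hy', key _ hz']
  have e : l * (A ^ (-u) * (1 + β * y)) + (1 - l) * (A ^ (-u) * (1 + β * z)) =
      A ^ (-u) * (1 + β * (l * y + (1 - l) * z)) := by ring
  rw [e, Real.mul_rpow (by positivity) hc.le, ← Real.rpow_mul hA.le]
  have e2 : -u * (1 / -u) = 1 := by field_simp
  rw [e2, Real.rpow_one]
  congr 2
  rw [div_neg]

/-- The set where a `(-u)`-concave function dominates a Pareto profile is an interval. -/
theorem paretoProfile_le_of_mem_Icc {u A β : ℝ} {h : ℝ → ℝ} (hu : 0 < u) (hA : 0 < A)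
    (hβ : 0 < β) (hh : BoundedSConcave (-u) h) {x y z : ℝ} (hx : 0 ≤ x) (hxy : x ≤ y)
    (hyz : y ≤ z) (h1 : paretoProfile u A β x ≤ h x) (h2 : paretoProfile u A β z ≤ h z) :
    paretoProfile u A β y ≤ h y := by
  rcases (hxy.trans hyz).eq_or_lt with rfl | hlt
  · obtain rfl := le_antisymm hxy hyz
    exact h1
  have hz : 0 ≤ z := hx.trans hlt.le
  have hd : 0 < z - x := sub_pos.2 hlt
  have hl : 0 ≤ (z - y) / (z - x) := div_nonneg (by linarith) hd.le
  have hl1 : (z - y) / (z - x) ≤ 1 := (div_le_one hd).2 (by linarith)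
  have e : (z - y) / (z - x) * x + (1 - (z - y) / (z - x)) * z = y := by
    field_simp
    ring
  have h3 := hh.concave x z _ hl hl1
  rw [smul_eq_mul, smul_eq_mul, e] at h3
  rw [← e, ← powerMean_paretoProfile hu hA hβ hl hl1 hx hz]
  rw [e]
  exact (powerMean_mono (neg_lt_zero.2 hu) hl hl1 (paretoProfile_pos hA hβ hx).le
    (paretoProfile_pos hA hβ hz).le h1 h2).trans h3

theorem integral_Ioi_one_add_mul_rpow {β q : ℝ} (hβ : 0 < β) (hq : 1 < q) :
    IntegrableOn (fun y : ℝ => (1 + β * y) ^ (-q)) (Set.Ioi 0) ∧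
      ∫ y in Set.Ioi (0 : ℝ), (1 + β * y) ^ (-q) = 1 / (β * (q - 1)) := by
  have hq1 : 0 < q - 1 := sub_pos.2 hq
  have hderiv : ∀ y ∈ Set.Ici (0 : ℝ), HasDerivAt
      (fun y => -(1 + β * y) ^ (-(q - 1)) / (β * (q - 1))) ((1 + β * y) ^ (-q)) y := by
    intro y hy
    have hy : 0 ≤ y := hy
    have hp : 0 < 1 + β * y := by positivity
    have h1 : HasDerivAt (fun y : ℝ => 1 + β * y) β y := by
      simpa using ((hasDerivAt_id y).const_mul β).const_add 1
    have h2 := ((h1.rpow_const (p := -(q - 1)) (Or.inl hp.ne')).neg).div_const (β * (q - 1))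
    convert! h2 using 1
    have e : -(q - 1) - 1 = -q := by ring
    rw [e]
    field_simp
  have htend : Filter.Tendsto (fun y => -(1 + β * y) ^ (-(q - 1)) / (β * (q - 1)))
      Filter.atTop (nhds 0) := by
    have h1 : Filter.Tendsto (fun y : ℝ => 1 + β * y) Filter.atTop Filter.atTop :=
      Filter.tendsto_atTop_add_const_left _ _ (Filter.tendsto_id.const_mul_atTop hβ)
    have h2 := (((tendsto_rpow_neg_atTop hq1).comp h1).neg).div_const (β * (q - 1))
    simpa using h2
  have hnn : ∀ y ∈ Set.Ioi (0 : ℝ), 0 ≤ (1 + β * y) ^ (-q) := by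
    intro y hy
    have hy : 0 < y := hy
    positivity
  have hi := integrableOn_Ioi_deriv_of_nonneg' hderiv hnn htend
  refine ⟨hi, ?_⟩
  rw [integral_Ioi_of_hasDerivAt_of_tendsto' hderiv hi htend]
  simp [neg_div]

theorem integral_paretoProfile {u A β : ℝ} (hu : 0 < u) (hu3 : u < 1 / 3) (hβ : 0 < β) :
    (IntegrableOn (fun y : ℝ => paretoProfile u A β y) (Set.Ioi 0) ∧
      IntegrableOn (fun y : ℝ => y * paretoProfile u A β y) (Set.Ioi 0) ∧
      IntegrableOn (fun y : ℝ => y ^ 2 * paretoProfile u A β y) (Set.Ioi 0)) ∧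
    ∫ y in Set.Ioi (0 : ℝ), paretoProfile u A β y = A / β * (u / (1 - u)) ∧
    ∫ y in Set.Ioi (0 : ℝ), y * paretoProfile u A β y =
      A / β ^ 2 * (u / (1 - u)) * (u / (1 - 2 * u)) ∧
    ∫ y in Set.Ioi (0 : ℝ), y ^ 2 * paretoProfile u A β y =
      2 * (A / β ^ 3) * (u / (1 - u)) * (u / (1 - 2 * u)) * (u / (1 - 3 * u)) := by
  have hr : 3 < 1 / u := by rw [lt_div_iff₀ hu]; linarith
  obtain ⟨i0, e0⟩ := integral_Ioi_one_add_mul_rpow hβ (show 1 < 1 / u by linarith)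
  obtain ⟨i1, e1⟩ := integral_Ioi_one_add_mul_rpow hβ (show 1 < 1 / u - 1 by linarith)
  obtain ⟨i2, e2⟩ := integral_Ioi_one_add_mul_rpow hβ (show 1 < 1 / u - 2 by linarith)
  have hpow : ∀ y ∈ Set.Ioi (0 : ℝ),
      (1 + β * y) ^ (-(1 / u - 1)) = (1 + β * y) * (1 + β * y) ^ (-(1 / u)) ∧
      (1 + β * y) ^ (-(1 / u - 2)) = (1 + β * y) ^ 2 * (1 + β * y) ^ (-(1 / u)) := by
    intro y hy
    have hy : 0 < y := hy
    have hp : 0 < 1 + β * y := by positivity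
    constructor
    · rw [← Real.rpow_one_add' hp.le (by linarith)]; congr 1; ring
    · rw [← Real.rpow_natCast, ← Real.rpow_add hp]; congr 1; push_cast; ring
  have c1 : ∀ y ∈ Set.Ioi (0 : ℝ), y * paretoProfile u A β y =
      A / β * ((1 + β * y) ^ (-(1 / u - 1)) - (1 + β * y) ^ (-(1 / u))) := by
    intro y hy
    rw [(hpow y hy).1, paretoProfile]
    field_simp
    ring
  have c2 : ∀ y ∈ Set.Ioi (0 : ℝ), y ^ 2 * paretoProfile u A β y =
      A / β ^ 2 * ((1 + β * y) ^ (-(1 / u - 2)) - 2 * (1 + β * y) ^ (-(1 / u - 1)) +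
        (1 + β * y) ^ (-(1 / u))) := by
    intro y hy
    rw [(hpow y hy).1, (hpow y hy).2, paretoProfile]
    field_simp
    ring
  have j0 : IntegrableOn (fun y : ℝ => paretoProfile u A β y) (Set.Ioi 0) := i0.const_mul A
  have j1 : IntegrableOn (fun y : ℝ => y * paretoProfile u A β y) (Set.Ioi 0) :=
    (integrableOn_congr_fun c1 measurableSet_Ioi).2 ((i1.sub i0).const_mul _)
  have j2 : IntegrableOn (fun y : ℝ => y ^ 2 * paretoProfile u A β y) (Set.Ioi 0) :=
    (integrableOn_congr_fun c2 measurableSet_Ioi).2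
      (((i2.sub (i1.const_mul 2)).add i0).const_mul _)
  have h1 : (1 : ℝ) - u ≠ 0 := by linarith
  have h2 : (1 : ℝ) - 2 * u ≠ 0 := by linarith
  have h2' : (1 : ℝ) - u * 2 ≠ 0 := by linarith
  have h3 : (1 : ℝ) - 3 * u ≠ 0 := by linarith
  have f1 : 1 / u - 1 = (1 - u) / u := by field_simp
  have f2 : 1 / u - 1 - 1 = (1 - 2 * u) / u := by field_simp; ring
  have f3 : 1 / u - 2 - 1 = (1 - 3 * u) / u := by field_simp; ring
  rw [f1] at e0
  rw [f2] at e1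
  rw [f3] at e2
  refine ⟨⟨j0, j1, j2⟩, ?_, ?_, ?_⟩
  · simp only [paretoProfile]
    rw [integral_const_mul, e0]
    field_simp
  · rw [setIntegral_congr_fun measurableSet_Ioi c1, integral_const_mul, integral_sub i1 i0, e0, e1]
    field_simp
    ring
  · have i21 : IntegrableOn (fun y : ℝ =>
        (1 + β * y) ^ (-(1 / u - 2)) - 2 * (1 + β * y) ^ (-(1 / u - 1))) (Set.Ioi 0) :=
      i2.sub (i1.const_mul 2)
    rw [setIntegral_congr_fun measurableSet_Ioi c2, integral_const_mul, integral_add i21 i0,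
      integral_sub i2 (i1.const_mul 2), integral_const_mul, e0, e1,
      e2]
    field_simp
    ring

namespace BoundedSConcave

variable {u : ℝ} {h : ℝ → ℝ}

theorem integrable_pow_mul {s : ℝ} (hh : BoundedSConcave s h) (k : ℕ) :
    Integrable fun y => y ^ k * h y := by
  obtain ⟨R, hR⟩ := hh.support
  refine ((hh.integrable volume).const_mul (|R| ^ k)).mono'
    ((measurable_id.pow_const k).mul hh.measurable).aestronglyMeasurable
    (Filter.Eventually.of_forall fun y => ?_)
  rw [norm_mul, norm_pow, Real.norm_of_nonneg (hh.nonneg y)]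
  rcases eq_or_ne (h y) 0 with e | hne
  · simp [e]
  · exact mul_le_mul_of_nonneg_right
      (pow_le_pow_left₀ (norm_nonneg _) ((hR y hne).trans (le_abs_self R)) k) (hh.nonneg y)

theorem integrable_mul {s : ℝ} (hh : BoundedSConcave s h) : Integrable fun y => y * h y := by
  simpa using hh.integrable_pow_mul 1

theorem ae_eq_zero_of_integral_pow_eq_zero {s : ℝ} (hh : BoundedSConcave s h) {k : ℕ}
    (h0 : ∫ y in Set.Ioi 0, y ^ k * h y = 0) :
    ∀ᵐ y ∂(volume.restrict (Set.Ioi (0 : ℝ))), h y = 0 := by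
  have hn : 0 ≤ᵐ[volume.restrict (Set.Ioi (0 : ℝ))] fun y => y ^ k * h y := by
    filter_upwards [ae_restrict_mem measurableSet_Ioi] with y hy
    exact mul_nonneg (pow_nonneg (le_of_lt hy) k) (hh.nonneg y)
  have h1 := (integral_eq_zero_iff_of_nonneg_ae hn (hh.integrable_pow_mul k).integrableOn).1 h0
  filter_upwards [h1, ae_restrict_mem measurableSet_Ioi] with y hy hy0
  have hy0 : 0 < y := hy0
  have hy1 : y ^ k * h y = 0 := hy
  exact (mul_eq_zero.1 hy1).resolve_left (pow_ne_zero _ hy0.ne')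

theorem isBounded_lt_paretoProfile (hh : BoundedSConcave (-u) h) {A β : ℝ} (hA : 0 < A)
    (hβ : 0 < β) :
    Bornology.IsBounded {y | 0 < y ∧ paretoProfile u A β y < h y} := by
  obtain ⟨R, hR⟩ := hh.support
  refine (Metric.isBounded_closedBall (x := (0 : ℝ)) (r := R)).subset fun x hx => ?_
  simpa using hR x ((paretoProfile_pos hA hβ hx.1.le).trans hx.2).ne'

/-- The first moment on a half-line is at most that of the Pareto profile with the same mass and
the same value at the origin, because the difference changes sign once, from plus to minus. -/
theorem mul_integral_le (hu : 0 < u) (hu3 : u < 1 / 3) (hh : BoundedSConcave (-u) h)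
    (h0 : 0 < h 0) (hp : 0 < ∫ y in Set.Ioi 0, h y) :
    h 0 * ∫ y in Set.Ioi 0, y * h y ≤ (1 - u) / (1 - 2 * u) * (∫ y in Set.Ioi 0, h y) ^ 2 := by
  set p := ∫ y in Set.Ioi 0, h y with hpdef
  have h1u : 0 < 1 - u := by linarith
  have h2u : 0 < 1 - 2 * u := by linarith
  have h2n : 1 - u * 2 ≠ 0 := by linarith
  set M := h 0 with hM
  -- the scale at which the Pareto profile of height `M` has mass `p`
  obtain ⟨β, hβdef⟩ : ∃ β, β = M / p * (u / (1 - u)) := ⟨_, rfl⟩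
  have hβ : 0 < β := by rw [hβdef]; positivity
  obtain ⟨⟨j0, j1, -⟩, e0, e1, -⟩ := integral_paretoProfile (A := M) hu hu3 hβ
  set P := paretoProfile u M β with hP
  have e0' : ∫ y in Set.Ioi 0, P y = p := by
    rw [e0, hβdef]; field_simp
  have hP0 : P 0 = M := by simp [hP, paretoProfile]
  set S := {y | 0 < y ∧ P y < h y} with hS
  have hSb : Bornology.IsBounded S := hh.isBounded_lt_paretoProfile h0 hβ
  -- `h - P` is nonnegative below `sSup S` and nonpositive above it
  have hpt : ∀ y ∈ Set.Ioi (0 : ℝ), (y * h y - y * P y) - (sSup S * h y - sSup S * P y) ≤ 0 := by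
    intro y hy
    have hy : 0 < y := hy
    have e : (y * h y - y * P y) - (sSup S * h y - sSup S * P y) =
      (y - sSup S) * (h y - P y) := by ring
    rw [e]
    rcases lt_or_ge y (sSup S) with hlt | hge
    · have hne : S.Nonempty := by
        by_contra hcon
        rw [Set.not_nonempty_iff_eq_empty.1 hcon, Real.sSup_empty] at hlt
        linarith
      obtain ⟨z, hz, hyz⟩ := exists_lt_of_lt_csSup hne hlt
      have := paretoProfile_le_of_mem_Icc hu h0 hβ hh le_rfl hy.le hyz.le hP0.le hz.2.le
      exact mul_nonpos_of_nonpos_of_nonneg (by linarith) (sub_nonneg.2 this)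
    · rcases hge.eq_or_lt with heq | hgt
      · simp [heq]
      · have : h y ≤ P y := by
          by_contra hcon
          exact absurd (le_csSup hSb.bddAbove ⟨hy, not_le.1 hcon⟩) (not_le.2 hgt)
        exact mul_nonpos_of_nonneg_of_nonpos (by linarith) (by linarith)
  have k0 : IntegrableOn h (Set.Ioi 0) := (hh.integrable volume).integrableOn
  have k1 : IntegrableOn (fun y => y * h y) (Set.Ioi 0) := hh.integrable_mul.integrableOn
  have hint := setIntegral_nonpos (μ := volume) measurableSet_Ioi hpt
  have d1 : IntegrableOn (fun y => y * h y - y * P y) (Set.Ioi 0) := k1.sub j1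
  have d0 : ∀ c, IntegrableOn (fun y => c * h y - c * P y) (Set.Ioi 0) :=
    fun c => (k0.const_mul c).sub (j0.const_mul c)
  rw [integral_sub d1 (d0 _), integral_sub k1 j1,
    integral_sub (k0.const_mul _) (j0.const_mul _), integral_const_mul, integral_const_mul, e0',
    e1, ← hpdef, sub_self, sub_zero, sub_nonpos] at hint
  calc M * ∫ y in Set.Ioi 0, y * h y
      ≤ M * (M / β ^ 2 * (u / (1 - u)) * (u / (1 - 2 * u))) := by gcongr
    _ = _ := by rw [hβdef]; field_simp

/-- The second moment on a half-line is at most that of the Pareto profile with the same mass and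
the same first moment, because the difference has at most two sign changes, in the pattern
minus, plus, minus. -/
theorem mul_integral_sq_le (hu : 0 < u) (hu3 : u < 1 / 3) (hh : BoundedSConcave (-u) h)
    (hp : 0 < ∫ y in Set.Ioi 0, h y) :
    (∫ y in Set.Ioi 0, h y) * ∫ y in Set.Ioi 0, y ^ 2 * h y ≤
      2 * ((1 - 2 * u) / (1 - 3 * u)) * (∫ y in Set.Ioi 0, y * h y) ^ 2 := by
  set p := ∫ y in Set.Ioi 0, h y with hpdef
  set a := ∫ y in Set.Ioi 0, y * h y with hadef
  have h1u : 0 < 1 - u := by linarith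
  have h2u : 0 < 1 - 2 * u := by linarith
  have h2n : 1 - u * 2 ≠ 0 := by linarith
  have h3u : 0 < 1 - 3 * u := by linarith
  have ha : 0 < a := by
    have hn : 0 ≤ a := setIntegral_nonneg measurableSet_Ioi fun y hy =>
      mul_nonneg (le_of_lt hy) (hh.nonneg y)
    refine hn.lt_of_ne fun hcon => hp.ne' ?_
    exact integral_eq_zero_of_ae (hh.ae_eq_zero_of_integral_pow_eq_zero (k := 1)
      (by simpa using hcon.symm))
  -- the scale and height at which the Pareto profile has mass `p` and first moment `a`
  obtain ⟨β, hβdef⟩ : ∃ β, β = p / a * (u / (1 - 2 * u)) := ⟨_, rfl⟩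
  have hβ : 0 < β := by rw [hβdef]; positivity
  obtain ⟨A, hAdef⟩ : ∃ A, A = p * β * ((1 - u) / u) := ⟨_, rfl⟩
  have hA : 0 < A := by rw [hAdef]; positivity
  obtain ⟨⟨j0, j1, j2⟩, e0, e1, e2⟩ := integral_paretoProfile (A := A) hu hu3 hβ
  set P := paretoProfile u A β with hP
  have e0' : ∫ y in Set.Ioi 0, P y = p := by
    rw [e0, hAdef]; field_simp
  have e1' : ∫ y in Set.Ioi 0, y * P y = a := by
    rw [e1, hAdef, hβdef]; field_simp
  set S := {y | 0 < y ∧ P y < h y} with hS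
  have hSb : Bornology.IsBounded S := hh.isBounded_lt_paretoProfile hA hβ
  -- `h - P` is nonnegative between `sInf S` and `sSup S` and nonpositive outside; if `S` is empty,
  -- both are `0`
  have hpt : ∀ y ∈ Set.Ioi (0 : ℝ), (y ^ 2 * h y - y ^ 2 * P y) -
      ((sInf S + sSup S) * (y * h y) - (sInf S + sSup S) * (y * P y)) +
      ((sInf S * sSup S) * h y - (sInf S * sSup S) * P y) ≤ 0 := by
    intro y hy
    have hy : 0 < y := hy
    have e : (y ^ 2 * h y - y ^ 2 * P y) -
      ((sInf S + sSup S) * (y * h y) - (sInf S + sSup S) * (y * P y)) +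
      ((sInf S * sSup S) * h y - (sInf S * sSup S) * P y) =
      ((y - sInf S) * (y - sSup S)) * (h y - P y) := by ring
    rw [e]
    have hIS := Real.sInf_le_sSup S hSb.bddBelow hSb.bddAbove
    by_cases hmem : sInf S < y ∧ y < sSup S
    · have hne : S.Nonempty := by
        by_contra hcon
        have := hmem.2
        rw [Set.not_nonempty_iff_eq_empty.1 hcon, Real.sSup_empty] at this
        linarith
      obtain ⟨z, hz, hyz⟩ := exists_lt_of_lt_csSup hne hmem.2
      obtain ⟨x, hx, hxy⟩ := exists_lt_of_csInf_lt hne hmem.1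
      have := paretoProfile_le_of_mem_Icc hu hA hβ hh hx.1.le hxy.le hyz.le hx.2.le hz.2.le
      exact mul_nonpos_of_nonpos_of_nonneg
        (mul_nonpos_of_nonneg_of_nonpos (by linarith) (by linarith)) (sub_nonneg.2 this)
    · have hout : y ≤ sInf S ∨ sSup S ≤ y := by
        by_contra! hcon
        exact hmem hcon
      have hprod : 0 ≤ (y - sInf S) * (y - sSup S) := by
        rcases hout with h1 | h1
        · exact mul_nonneg_of_nonpos_of_nonpos (by linarith) (by linarith)
        · exact mul_nonneg (by linarith) (by linarith)
      by_cases hyS : y ∈ S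
      · have hI := csInf_le hSb.bddBelow hyS
        have hJ := le_csSup hSb.bddAbove hyS
        have hz : (y - sInf S) * (y - sSup S) = 0 := by
          rcases hout with h1 | h1
          · rw [le_antisymm h1 hI]; simp
          · rw [le_antisymm hJ h1]; simp
        simp [hz]
      · have : h y ≤ P y := by
          by_contra hcon
          exact hyS ⟨hy, not_le.1 hcon⟩
        exact mul_nonpos_of_nonneg_of_nonpos hprod (by linarith)
  have k0 : IntegrableOn h (Set.Ioi 0) := (hh.integrable volume).integrableOn
  have k1 : IntegrableOn (fun y => y * h y) (Set.Ioi 0) := hh.integrable_mul.integrableOn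
  have k2 : IntegrableOn (fun y => y ^ 2 * h y) (Set.Ioi 0) :=
    (hh.integrable_pow_mul 2).integrableOn
  have hint := setIntegral_nonpos (μ := volume) measurableSet_Ioi hpt
  have d2 : IntegrableOn (fun y => y ^ 2 * h y - y ^ 2 * P y) (Set.Ioi 0) := k2.sub j2
  have d1 : ∀ c, IntegrableOn (fun y => c * (y * h y) - c * (y * P y)) (Set.Ioi 0) :=
    fun c => (k1.const_mul c).sub (j1.const_mul c)
  have d0 : ∀ c, IntegrableOn (fun y => c * h y - c * P y) (Set.Ioi 0) :=
    fun c => (k0.const_mul c).sub (j0.const_mul c)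
  have d21 : ∀ c, IntegrableOn (fun y => (y ^ 2 * h y - y ^ 2 * P y) -
      (c * (y * h y) - c * (y * P y))) (Set.Ioi 0) := fun c => d2.sub (d1 c)
  rw [integral_add (d21 _) (d0 _), integral_sub d2 (d1 _), integral_sub k2 j2,
    integral_sub (k1.const_mul _) (j1.const_mul _), integral_sub (k0.const_mul _) (j0.const_mul _),
    integral_const_mul, integral_const_mul, integral_const_mul, integral_const_mul, e0', e1', e2,
    ← hpdef, ← hadef, sub_self, sub_self, sub_zero, add_zero, sub_nonpos] at hint
  calc p * ∫ y in Set.Ioi 0, y ^ 2 * h y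
      ≤ p * (2 * (A / β ^ 3) * (u / (1 - u)) * (u / (1 - 2 * u)) * (u / (1 - 3 * u))) := by gcongr
    _ = _ := by rw [hAdef, hβdef]; field_simp

/-- The two moment inequalities on a half-line, with the first moment written as `D p / h 0`. -/
theorem exists_halfline_moments (hu : 0 < u) (hu3 : u < 1 / 3) (hh : BoundedSConcave (-u) h)
    (h0 : 0 < h 0) :
    ∃ D, 0 ≤ D ∧ D ≤ (1 - u) / (1 - 2 * u) * ∫ y in Set.Ioi 0, h y ∧
      h 0 * ∫ y in Set.Ioi 0, y * h y = D * ∫ y in Set.Ioi 0, h y ∧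
      h 0 ^ 2 * ∫ y in Set.Ioi 0, y ^ 2 * h y ≤
        2 * ((1 - 2 * u) / (1 - 3 * u)) * D ^ 2 * ∫ y in Set.Ioi 0, h y := by
  have hpn : 0 ≤ ∫ y in Set.Ioi 0, h y :=
    setIntegral_nonneg measurableSet_Ioi fun y _ => hh.nonneg y
  rcases hpn.eq_or_lt with hp | hp
  · have hz := hh.ae_eq_zero_of_integral_pow_eq_zero (k := 0) (by simpa using hp.symm)
    refine ⟨0, le_rfl, by simp [← hp], ?_, ?_⟩
    · rw [integral_eq_zero_of_ae]
      · simp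
      · filter_upwards [hz] with y hy
        simp [hy]
    · rw [integral_eq_zero_of_ae]
      · simp
      · filter_upwards [hz] with y hy
        simp [hy]
  · have h1 := hh.mul_integral_le hu hu3 h0 hp
    have h2 := hh.mul_integral_sq_le hu hu3 hp
    set p := ∫ y in Set.Ioi 0, h y
    set a := ∫ y in Set.Ioi 0, y * h y with hadef
    set b := ∫ y in Set.Ioi 0, y ^ 2 * h y
    have ha : 0 ≤ a := setIntegral_nonneg measurableSet_Ioi fun y hy =>
      mul_nonneg (le_of_lt hy) (hh.nonneg y)
    refine ⟨h 0 * a / p, by positivity, ?_, ?_, ?_⟩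
    · rw [div_le_iff₀ hp]; nlinarith
    · field_simp
    · have e : 2 * ((1 - 2 * u) / (1 - 3 * u)) * (h 0 * a / p) ^ 2 * p =
        h 0 ^ 2 * (2 * ((1 - 2 * u) / (1 - 3 * u)) * a ^ 2 / p) := by
        field_simp
      rw [e]
      gcongr
      rw [le_div_iff₀ hp]; linarith

end BoundedSConcave

/-! ### The peak of a density of given variance -/

theorem integral_eq_integral_Ioi_add {f : ℝ → ℝ} (hf : Integrable f) :
    ∫ x, f x = (∫ x in Set.Ioi 0, f x) + ∫ x in Set.Ioi 0, f (-x) := by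
  rw [integral_comp_neg_Ioi, neg_zero, add_comm]
  exact (intervalIntegral.integral_Iic_add_Ioi hf.integrableOn hf.integrableOn).symm

/-- The moment inequalities of the two sides of a peak bound the variance: the bound is increasing
in the first moments `M⁻¹ D p` and `M⁻¹ E q`, and after inserting their largest values it is
largest when all the mass lies on one side. -/
theorem variance_le_of_halfline_moments {u p q D E M a₁ a₂ b₁ b₂ : ℝ} (hu : 0 < u)
    (hu3 : u < 1 / 3) (hp : 0 ≤ p) (hq : 0 ≤ q) (hD : 0 ≤ D) (hE : 0 ≤ E)
    (hDp : D ≤ (1 - u) / (1 - 2 * u) * p) (hEq : E ≤ (1 - u) / (1 - 2 * u) * q)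
    (ha₁ : M * a₁ = D * p) (hb₁ : M * b₁ = E * q)
    (ha₂ : M ^ 2 * a₂ ≤ 2 * ((1 - 2 * u) / (1 - 3 * u)) * D ^ 2 * p)
    (hb₂ : M ^ 2 * b₂ ≤ 2 * ((1 - 2 * u) / (1 - 3 * u)) * E ^ 2 * q) :
    M ^ 2 * ((p + q) * (a₂ + b₂) - (a₁ - b₁) ^ 2) ≤
      ((1 - u) / (1 - 3 * u)) ^ 2 * (p + q) ^ 4 := by
  have h1u : 0 < 1 - u := by linarith
  have h2u : 0 < 1 - 2 * u := by linarith
  have h3u : 0 < 1 - 3 * u := by linarith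
  set e := (1 - u) / (1 - 2 * u) with he
  set c := (1 - 2 * u) / (1 - 3 * u) with hc
  have hc1 : 1 ≤ c := by rw [hc, le_div_iff₀ h3u]; linarith
  have he0 : 0 < e := by positivity
  have hpq := mul_nonneg hp hq
  have hDsq : D ^ 2 ≤ (e * p) ^ 2 := pow_le_pow_left₀ hD hDp 2
  have hEsq : E ^ 2 ≤ (e * q) ^ 2 := pow_le_pow_left₀ hE hEq 2
  have hDE : D * E ≤ (e * p) * (e * q) := mul_le_mul hDp hEq hE (by positivity)
  have hcp : 0 ≤ 2 * c * p * (p + q) - p ^ 2 := by nlinarith [mul_nonneg hp (add_nonneg hp hq)]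
  have hcq : 0 ≤ 2 * c * q * (p + q) - q ^ 2 := by nlinarith [mul_nonneg hq (add_nonneg hp hq)]
  have hconst : e ^ 2 * (2 * c - 1) ≤ ((1 - u) / (1 - 3 * u)) ^ 2 := by
    have e1 : 2 * c - 1 = (1 - u) / (1 - 3 * u) := by
      rw [hc, eq_div_iff h3u.ne', sub_mul, mul_assoc, div_mul_cancel₀ _ h3u.ne']; ring
    rw [e1, he, div_pow, div_pow, div_mul_div_comm, div_le_div_iff₀ (by positivity) (by positivity)]
    have : (1 - u) * (1 - 3 * u) ≤ (1 - 2 * u) ^ 2 := by nlinarith [sq_nonneg u]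
    have h4 : 0 ≤ (1 - u) ^ 2 * (1 - 3 * u) := by positivity
    nlinarith [mul_le_mul_of_nonneg_left this h4]
  calc M ^ 2 * ((p + q) * (a₂ + b₂) - (a₁ - b₁) ^ 2)
      = (p + q) * (M ^ 2 * a₂ + M ^ 2 * b₂) - (M * a₁ - M * b₁) ^ 2 := by ring
    _ ≤ (p + q) * (2 * c * D ^ 2 * p + 2 * c * E ^ 2 * q) - (D * p - E * q) ^ 2 := by
        rw [ha₁, hb₁]; gcongr
    _ = (2 * c * p * (p + q) - p ^ 2) * D ^ 2 + (2 * c * q * (p + q) - q ^ 2) * E ^ 2 +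
        2 * (p * q) * (D * E) := by ring
    _ ≤ (2 * c * p * (p + q) - p ^ 2) * (e * p) ^ 2 +
        (2 * c * q * (p + q) - q ^ 2) * (e * q) ^ 2 + 2 * (p * q) * (e * p * (e * q)) := by gcongr
    _ = e ^ 2 * (2 * c - 1) * (p + q) ^ 4 -
        e ^ 2 * (p + q) ^ 2 * ((6 * c - 4) * (p * q)) := by ring
    _ ≤ e ^ 2 * (2 * c - 1) * (p + q) ^ 4 := by
        have : 0 ≤ e ^ 2 * (p + q) ^ 2 * ((6 * c - 4) * (p * q)) := by
          have : 0 ≤ 6 * c - 4 := by linarith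
          positivity
        linarith
    _ ≤ _ := by gcongr

namespace BoundedSConcave

variable {u : ℝ} {g : ℝ → ℝ}

theorem sq_apply_zero_mul_variance_le (hu : 0 < u) (hu3 : u < 1 / 3)
    (hg : BoundedSConcave (-u) g) :
    g 0 ^ 2 * ((∫ x, g x) * (∫ x, x ^ 2 * g x) - (∫ x, x * g x) ^ 2) ≤
      ((1 - u) / (1 - 3 * u)) ^ 2 * (∫ x, g x) ^ 4 := by
  rcases (hg.nonneg 0).eq_or_lt with h0 | h0
  · rw [← h0]
    have : 0 ≤ ((1 - u) / (1 - 3 * u)) ^ 2 * (∫ x, g x) ^ 4 := by positivity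
    simpa using this
  have hr : BoundedSConcave (-u) fun x => g (-x) := by
    refine hg.comp_affine measurable_neg 0 (fun x => by simp) fun x y l => ?_
    simp only [smul_eq_mul]; ring
  obtain ⟨D, hD, hDp, ha₁, ha₂⟩ := hg.exists_halfline_moments hu hu3 h0
  obtain ⟨E, hE, hEq, hb₁, hb₂⟩ := hr.exists_halfline_moments hu hu3 (by simpa using h0)
  have s0 := integral_eq_integral_Ioi_add (hg.integrable volume)
  have s1 := integral_eq_integral_Ioi_add hg.integrable_mul
  have s2 := integral_eq_integral_Ioi_add (hg.integrable_pow_mul 2)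
  simp only [neg_mul, integral_neg, even_two, Even.neg_pow, ← sub_eq_add_neg] at s1 s2
  rw [s0, s1, s2]
  simp only [neg_zero] at hb₁ hb₂
  exact variance_le_of_halfline_moments hu hu3
    (setIntegral_nonneg measurableSet_Ioi fun y _ => hg.nonneg y)
    (setIntegral_nonneg measurableSet_Ioi fun y _ => hg.nonneg _) hD hE hDp hEq ha₁ hb₁ ha₂ hb₂

/-- The value of a `(-u)`-concave density at any point, against its mass and variance; both sides
are written through unnormalized moments. -/
theorem sq_mul_variance_le (hu : 0 < u) (hu3 : u < 1 / 3)
    (hg : BoundedSConcave (-u) g) (x₀ : ℝ) :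
    g x₀ ^ 2 * ((∫ x, g x) * (∫ x, x ^ 2 * g x) - (∫ x, x * g x) ^ 2) ≤
      ((1 - u) / (1 - 3 * u)) ^ 2 * (∫ x, g x) ^ 4 := by
  have hs : BoundedSConcave (-u) fun x => g (x + x₀) := by
    refine hg.comp_affine (measurable_add_const x₀) |x₀| (fun x => ?_) fun x y l => ?_
    · calc ‖x‖ = ‖x + x₀ - x₀‖ := by simp
        _ ≤ _ := norm_sub_le _ _
    · simp only [smul_eq_mul]; ring
  have h := hs.sq_apply_zero_mul_variance_le hu hu3
  have i0 := hg.integrable volume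
  have i1 := hg.integrable_mul
  have i2 := hg.integrable_pow_mul 2
  have e0 : ∫ x, g (x + x₀) = ∫ x, g x := integral_add_right_eq_self g x₀
  have e1 : ∫ x, x * g (x + x₀) = (∫ x, x * g x) - x₀ * ∫ x, g x := by
    rw [← integral_const_mul, ← integral_sub i1 (i0.const_mul _),
      ← integral_add_right_eq_self (fun x => x * g x - x₀ * g x) x₀]
    exact integral_congr_ae (Filter.Eventually.of_forall fun x => by ring)
  have e2 : ∫ x, x ^ 2 * g (x + x₀) =
      (∫ x, x ^ 2 * g x) - 2 * x₀ * (∫ x, x * g x) + x₀ ^ 2 * ∫ x, g x := by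
    have i21 : Integrable fun x => x ^ 2 * g x - 2 * x₀ * (x * g x) := i2.sub (i1.const_mul _)
    rw [← integral_const_mul, ← integral_const_mul, ← integral_sub i2 (i1.const_mul _),
      ← integral_add i21 (i0.const_mul _), ← integral_add_right_eq_self
        (fun x => x ^ 2 * g x - 2 * x₀ * (x * g x) + x₀ ^ 2 * g x) x₀]
    exact integral_congr_ae (Filter.Eventually.of_forall fun x => by ring)
  rw [e0, e1, e2, zero_add] at h
  convert! h using 2
  ring

end BoundedSConcave

/-! ### Densities of one-dimensional marginals -/

open Filter Topology in
theorem tendsto_of_eventually_eq_atTop {f : ℕ → ℝ} {a : ℝ}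
    (h : ∃ N : ℝ, ∀ m : ℕ, N ≤ m → f m = a) :
    Tendsto f atTop (𝓝 a) := by
  obtain ⟨N, hN⟩ := h
  obtain ⟨M, hM⟩ := exists_nat_ge N
  refine tendsto_const_nhds.congr' ?_
  filter_upwards [eventually_ge_atTop M] with m hm
  exact (hN m (hM.trans (Nat.cast_le.2 hm))).symm

/-- The ballTruncation of a function in height and to a ball. It preserves `s`-concavity. -/
noncomputable def ballTruncation {E : Type*} [NormedAddCommGroup E] (m : ℕ) (F : E → ℝ) (p : E) :
    ℝ :=
  if ‖p‖ ≤ m then min (F p) m else 0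

section Truncation

variable {E : Type*} [NormedAddCommGroup E] {s : ℝ} {F : E → ℝ}

theorem ballTruncation_nonneg (h0 : ∀ p, 0 ≤ F p) (m : ℕ) (p : E) : 0 ≤ ballTruncation m F p := by
  unfold ballTruncation
  split_ifs
  · exact le_min (h0 p) (Nat.cast_nonneg m)
  · exact le_rfl

theorem ballTruncation_le (h0 : ∀ p, 0 ≤ F p) (m : ℕ) (p : E) : ballTruncation m F p ≤ F p := by
  unfold ballTruncation
  split_ifs
  · exact min_le_left _ _
  · exact h0 p

theorem ballTruncation_mono (h0 : ∀ p, 0 ≤ F p) (p : E) :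
    Monotone fun m => ballTruncation m F p := by
  intro m n hmn
  have hmn' : (m : ℝ) ≤ n := Nat.cast_le.2 hmn
  by_cases h : ‖p‖ ≤ m
  · simp only [ballTruncation, h, h.trans hmn', if_true]
    exact min_le_min le_rfl hmn'
  · simp only [ballTruncation, h, if_false]
    exact ballTruncation_nonneg h0 n p

theorem tendsto_ballTruncation (p : E) :
    Filter.Tendsto (fun m => ballTruncation m F p) Filter.atTop (nhds (F p)) := by
  refine tendsto_of_eventually_eq_atTop ⟨max ‖p‖ (F p), fun m hm => ?_⟩
  rw [ballTruncation, if_pos ((le_max_left _ _).trans hm), min_eq_left ((le_max_right _ _).trans hm)]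

theorem boundedSConcave_ballTruncation [NormedSpace ℝ E] [MeasurableSpace E]
    [OpensMeasurableSpace E] (hs : s < 0) (hF : Measurable F)
    (h0 : ∀ p, 0 ≤ F p)
    (hc : ∀ x y : E, ∀ l : ℝ, 0 ≤ l → l ≤ 1 →
      powerMean s l (F x) (F y) ≤ F (l • x + (1 - l) • y)) (m : ℕ) :
    BoundedSConcave s (ballTruncation m F) where
  measurable := Measurable.ite (measurableSet_le measurable_norm measurable_const)
    (hF.min measurable_const) measurable_const
  nonneg := ballTruncation_nonneg h0 m
  bounded := ⟨m, fun p => by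
    unfold ballTruncation
    split_ifs
    · exact min_le_right _ _
    · exact Nat.cast_nonneg m⟩
  support := ⟨m, fun p hp => by
    by_contra hcon
    simp [ballTruncation, hcon] at hp⟩
  concave x y l hl hl1 := by
    have hm : (0 : ℝ) ≤ m := Nat.cast_nonneg m
    by_cases hx : ‖x‖ ≤ m
    · by_cases hy : ‖y‖ ≤ m
      · have hz : ‖l • x + (1 - l) • y‖ ≤ m := by
          have := (convex_closedBall (0 : E) m) (x := x) (by simpa using hx) (y := y)
            (by simpa using hy) hl (sub_nonneg.2 hl1) (by ring)
          simpa using this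
        simp only [ballTruncation, hx, hy, hz, if_true]
        have hx0 := le_min (h0 x) hm
        have hy0 := le_min (h0 y) hm
        refine le_min ?_ ?_
        · exact (powerMean_mono hs hl hl1 hx0 hy0 (min_le_left _ _) (min_le_left _ _)).trans
            (hc x y l hl hl1)
        · calc _ ≤ powerMean s l (m : ℝ) m :=
              powerMean_mono hs hl hl1 hx0 hy0 (min_le_right _ _) (min_le_right _ _)
            _ = m := powerMean_self hs hm
      · rw [powerMean_eq_zero (Or.inr (by simp [ballTruncation, hy]))]
        exact ballTruncation_nonneg h0 m _
    · rw [powerMean_eq_zero (Or.inl (by simp [ballTruncation, hx]))]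
      exact ballTruncation_nonneg h0 m _

end Truncation

/-- The first-coordinate marginal of a centred `s`-concave distribution with unit variance has a
bounded quasi-concave density. -/
theorem exists_bounded_marginal_density {k : ℕ} {s u : ℝ} (hs : s < 0)
    (hs3 : 0 < 1 + ((k : ℝ) + 3) * s) (hu : u = -(s / (1 + k * s)))
    {F : ℝ × (Fin k → ℝ) → ℝ} (hF : Measurable F) (h0 : ∀ p, 0 ≤ F p)
    (hc : ∀ x y : ℝ × (Fin k → ℝ), ∀ l : ℝ, 0 ≤ l → l ≤ 1 →
      powerMean s l (F x) (F y) ≤ F (l • x + (1 - l) • y))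
    (i0 : Integrable F) (i1 : Integrable fun p => p.1 * F p)
    (i2 : Integrable fun p => p.1 ^ 2 * F p)
    (m0 : ∫ p, F p = 1) (m1 : ∫ p, p.1 * F p = 0) (m2 : ∫ p, p.1 ^ 2 * F p = 1) :
    ∃ g : ℝ → ℝ, Measurable g ∧ (∀ x, 0 ≤ g x) ∧ (∀ x, g x ≤ (1 - u) / (1 - 3 * u)) ∧
      (∀ x y z, x ≤ y → y ≤ z → min (g x) (g z) ≤ g y) ∧
      (volume.withDensity fun p => ENNReal.ofReal (F p)).map Prod.fst =
        volume.withDensity fun x => ENNReal.ofReal (g x) := by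
  have hk0 : (0 : ℝ) ≤ k := Nat.cast_nonneg k
  have hk1 : 0 < 1 + (k : ℝ) * s := by nlinarith
  have hs' : s / (1 + k * s) = -u := by rw [hu, neg_neg]
  have hu0 : 0 < u := by rw [hu]; exact neg_pos.2 (div_neg_of_neg_of_pos hs hk1)
  have hu3 : u < 1 / 3 := by
    rw [hu, ← neg_div, div_lt_iff₀ hk1]; linarith
  have hC : 0 < (1 - u) / (1 - 3 * u) := div_pos (by linarith) (by linarith)
  set C := (1 - u) / (1 - 3 * u) with hCdef
  have hT := boundedSConcave_ballTruncation hs hF h0 hc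
  let G : ℕ → ℝ → ℝ := fun m x => ∫ y, ballTruncation m F (x, y)
  have hG : ∀ m, BoundedSConcave (-u) (G m) := fun m => by
    rw [← hs']; exact (hT m).marginal_pi k hs hk1
  have hmom : ∀ j : ℕ, Integrable (fun p : ℝ × (Fin k → ℝ) => p.1 ^ j * F p) →
      Filter.Tendsto (fun m => ∫ x, x ^ j * G m x) Filter.atTop (nhds (∫ p, p.1 ^ j * F p)) := by
    intro j hj
    have hmeas : ∀ m, Measurable fun p : ℝ × (Fin k → ℝ) => p.1 ^ j * ballTruncation m F p :=
      fun m => (measurable_fst.pow_const j).mul (hT m).measurable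
    have hbd : ∀ m (p : ℝ × (Fin k → ℝ)), ‖p.1 ^ j * ballTruncation m F p‖ ≤ ‖p.1 ^ j * F p‖ := by
      intro m p
      rw [norm_mul, norm_mul, Real.norm_of_nonneg (h0 p),
        Real.norm_of_nonneg (ballTruncation_nonneg h0 m p)]
      exact mul_le_mul_of_nonneg_left (ballTruncation_le h0 m p) (norm_nonneg _)
    have hfub : ∀ m, ∫ x, x ^ j * G m x = ∫ p, p.1 ^ j * ballTruncation m F p := by
      intro m
      have hi : Integrable (fun p : ℝ × (Fin k → ℝ) => p.1 ^ j * ballTruncation m F p)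
          (volume.prod volume) :=
        hj.norm.mono' (hmeas m).aestronglyMeasurable (Filter.Eventually.of_forall (hbd m))
      rw [Measure.volume_eq_prod, integral_prod _ hi]
      simp only [integral_const_mul, G]
    simp only [hfub]
    refine tendsto_integral_of_dominated_convergence (fun p => ‖p.1 ^ j * F p‖)
      (fun m => (hmeas m).aestronglyMeasurable) hj.norm
      (fun m => Filter.Eventually.of_forall (hbd m)) (Filter.Eventually.of_forall fun p => ?_)
    exact (tendsto_ballTruncation p).const_mul _
  have t0 : Filter.Tendsto (fun m => ∫ x, G m x) Filter.atTop (nhds 1) := by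
    have := hmom 0 (by simpa using i0)
    simpa [m0] using this
  have t1 : Filter.Tendsto (fun m => ∫ x, x * G m x) Filter.atTop (nhds 0) := by
    have := hmom 1 (by simpa using i1)
    simpa [m1] using this
  have t2 : Filter.Tendsto (fun m => ∫ x, x ^ 2 * G m x) Filter.atTop (nhds 1) := by
    have := hmom 2 i2
    rwa [m2] at this
  have tV := (t0.mul t2).sub (t1.pow 2)
  have e1 : (1 : ℝ) * 1 - 0 ^ 2 = 1 := by norm_num
  rw [e1] at tV
  let L : ℝ → ENNReal := fun x => ∫⁻ y, ENNReal.ofReal (F (x, y))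
  have hLmeas : Measurable L := (hF.ennreal_ofReal).lintegral_prod_right'
  have tL : ∀ x, Filter.Tendsto (fun m => ENNReal.ofReal (G m x)) Filter.atTop (nhds (L x)) := by
    intro x
    have e : ∀ m, ENNReal.ofReal (G m x) = ∫⁻ y, ENNReal.ofReal (ballTruncation m F (x, y)) :=
      fun m => ofReal_integral_eq_lintegral_ofReal (((hT m).fibre x).integrable volume)
        (Filter.Eventually.of_forall fun y => ballTruncation_nonneg h0 m _)
    simp only [e]
    refine lintegral_tendsto_of_tendsto_of_monotone
      (fun m => ((hT m).fibre x).measurable.ennreal_ofReal.aemeasurable)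
      (Filter.Eventually.of_forall fun y m n hmn =>
        ENNReal.ofReal_le_ofReal (ballTruncation_mono h0 (x, y) hmn))
      (Filter.Eventually.of_forall fun y =>
        ENNReal.tendsto_ofReal (tendsto_ballTruncation (x, y)))
  have hLC : ∀ x, L x ≤ ENNReal.ofReal C := by
    intro x
    have hlim : Filter.Tendsto (fun m => ENNReal.ofReal (√(C ^ 2 * (∫ x, G m x) ^ 4 /
        ((∫ x, G m x) * (∫ x, x ^ 2 * G m x) - (∫ x, x * G m x) ^ 2)))) Filter.atTop
        (nhds (ENNReal.ofReal C)) := by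
      refine ENNReal.tendsto_ofReal ?_
      have h1 := (((t0.pow 4).const_mul (C ^ 2)).div tV one_ne_zero).sqrt
      have e2 : √(C ^ 2 * 1 ^ 4 / 1) = C := by
        rw [one_pow, mul_one, div_one, Real.sqrt_sq hC.le]
      rwa [e2] at h1
    refine le_of_tendsto_of_tendsto (tL x) hlim ?_
    filter_upwards [tV.eventually (lt_mem_nhds (show (0 : ℝ) < 1 by norm_num))] with m hm
    refine ENNReal.ofReal_le_ofReal (Real.le_sqrt_of_sq_le ?_)
    rw [le_div_iff₀ hm]
    exact (hG m).sq_mul_variance_le hu0 hu3 x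
  have hLtop : ∀ x, L x ≠ ⊤ := fun x => ((hLC x).trans_lt ENNReal.ofReal_lt_top).ne
  have tg : ∀ x, Filter.Tendsto (fun m => G m x) Filter.atTop (nhds (L x).toReal) := by
    intro x
    have := (ENNReal.tendsto_toReal (hLtop x)).comp (tL x)
    refine this.congr fun m => ?_
    exact ENNReal.toReal_ofReal ((hG m).nonneg x)
  refine ⟨fun x => (L x).toReal, hLmeas.ennreal_toReal, fun x => ENNReal.toReal_nonneg,
    fun x => ?_, fun x y z hxy hyz => ?_, ?_⟩
  · exact (ENNReal.toReal_le_of_le_ofReal hC.le (hLC x))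
  · exact le_of_tendsto_of_tendsto' ((tg x).min (tg z)) (tg y) fun m =>
      (hG m).min_le_of_mem_Icc (neg_lt_zero.2 hu0) hxy hyz
  · ext A hA
    have hAm : MeasurableSet (Prod.fst ⁻¹' A : Set (ℝ × (Fin k → ℝ))) := measurable_fst hA
    rw [Measure.map_apply measurable_fst hA, withDensity_apply _ hAm, withDensity_apply _ hA]
    simp only [ENNReal.ofReal_toReal (hLtop _)]
    have e : (Prod.fst ⁻¹' A : Set (ℝ × (Fin k → ℝ))) = A ×ˢ Set.univ := by
      ext p; simp
    rw [e, Measure.volume_eq_prod, ← Measure.prod_restrict, Measure.restrict_univ,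
      lintegral_prod _ hF.ennreal_ofReal.aemeasurable]

/-! ### Mass of a band around the mean -/

/-- Among functions on the half-line bounded by `c` with a given integral, the moments are smallest
for the multiple `c` of the indicator of an initial interval. -/
theorem pow_integral_le_mul_moment {k : ℝ → ℝ} {c : ℝ} (hc : 0 < c)
    (h0 : ∀ y ∈ Set.Ioi (0 : ℝ), 0 ≤ k y) (hk : ∀ y ∈ Set.Ioi (0 : ℝ), k y ≤ c) (j : ℕ)
    (i0 : IntegrableOn k (Set.Ioi 0)) (ij : IntegrableOn (fun y => y ^ j * k y) (Set.Ioi 0)) :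
    (∫ y in Set.Ioi 0, k y) ^ (j + 1) ≤ ((j : ℝ) + 1) * c ^ j * ∫ y in Set.Ioi 0, y ^ j * k y := by
  set q := ∫ y in Set.Ioi 0, k y with hq
  have hq0 : 0 ≤ q := setIntegral_nonneg measurableSet_Ioi h0
  set r := q / c with hr
  have hr0 : 0 ≤ r := by positivity
  let f : ℝ → ℝ := fun y => c * (r ^ j - y ^ j)
  have hfc : Continuous f := by fun_prop
  have hfi : IntegrableOn ((Set.Ioc 0 r).indicator f) (Set.Ioi 0) :=
    ((integrable_indicator_iff measurableSet_Ioc).2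
      (hfc.integrableOn_Icc.mono_set Set.Ioc_subset_Icc_self)).integrableOn
  have hfe : ∫ y in Set.Ioi 0, (Set.Ioc 0 r).indicator f y =
      c * (r ^ j * r - r ^ (j + 1) / (j + 1)) := by
    have hinter : Set.Ioi 0 ∩ Set.Ioc 0 r = Set.Ioc 0 r :=
      Set.inter_eq_right.2 fun y hy => hy.1
    rw [setIntegral_indicator measurableSet_Ioc, hinter,
      ← intervalIntegral.integral_of_le hr0, intervalIntegral.integral_const_mul,
      intervalIntegral.integral_sub intervalIntegrable_const
        ((continuous_pow j).intervalIntegrable _ _), integral_pow]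
    simp [mul_comm]
  have hpt : ∀ y ∈ Set.Ioi (0 : ℝ), r ^ j * k y - (Set.Ioc 0 r).indicator f y ≤ y ^ j * k y := by
    intro y hy
    have hy' : 0 < y := hy
    by_cases hyr : y ≤ r
    · rw [Set.indicator_of_mem (show y ∈ Set.Ioc 0 r from ⟨hy, hyr⟩)]
      have h1 : y ^ j ≤ r ^ j := pow_le_pow_left₀ hy'.le hyr j
      have h2 := mul_nonneg (sub_nonneg.2 h1) (sub_nonneg.2 (hk y hy))
      simp only [f]
      nlinarith
    · rw [Set.indicator_of_notMem fun h => hyr h.2, sub_zero]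
      exact mul_le_mul_of_nonneg_right (pow_le_pow_left₀ hr0 (not_le.1 hyr).le j) (h0 y hy)
  have hint := setIntegral_mono_on ((i0.const_mul (r ^ j)).sub hfi) ij measurableSet_Ioi hpt
  have hsub : ∫ y in Set.Ioi 0, (r ^ j * k y - (Set.Ioc 0 r).indicator f y) =
      r ^ j * q - c * (r ^ j * r - r ^ (j + 1) / (j + 1)) := by
    rw [integral_sub (i0.const_mul (r ^ j)) hfi, hfe, integral_const_mul]
  have hqr : q = c * r := by rw [hr]; field_simp
  have hint' : r ^ j * q - c * (r ^ j * r - r ^ (j + 1) / (j + 1)) ≤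
      ∫ y in Set.Ioi 0, y ^ j * k y := hsub ▸ hint
  have hj : (0 : ℝ) < (j : ℝ) + 1 := by positivity
  calc q ^ (j + 1) = ((j : ℝ) + 1) * c ^ j *
        (r ^ j * q - c * (r ^ j * r - r ^ (j + 1) / (j + 1))) := by
        rw [hqr]; field_simp; ring
    _ ≤ _ := by gcongr

/-- A function that is `≤ M`, with the moments of a centred probability density of variance `1`,
takes a value above `1 / 1000` beyond any point `t ≤ 1 / (8 M)`: otherwise the mass `R` beyond `t`
would be at most `0.015`, while the first moment beyond `t`, which balances the one on the other
side, would be at least `0.18`; both contradict the second moment being about `1`. -/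
theorem exists_large_value_right {g : ℝ → ℝ} {M t : ℝ} (h0 : ∀ x, 0 ≤ g x) (hM : ∀ x, g x ≤ M)
    (hM1 : 1 ≤ M) (hM2 : M ≤ 2) (i0 : Integrable g) (i1 : Integrable fun x => x * g x)
    (i2 : Integrable fun x => x ^ 2 * g x) (m0 : ∫ x, g x = 1) (m1 : ∫ x, x * g x = 0)
    (m2 : ∫ x, x ^ 2 * g x = 1) (ht : 0 < t) (htM : t * M ≤ 1 / 8) :
    ∃ x, t < x ∧ 1 / 1000 < g x := by
  by_contra! hcon
  let h : ℝ → ℝ := fun y => g (y + t)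
  have j0 : Integrable h := i0.comp_add_right t
  have j1 : Integrable fun y => y * h y := by
    have := (i1.sub (i0.const_mul t)).comp_add_right t
    refine this.congr (Filter.Eventually.of_forall fun y => ?_)
    simp only [Pi.sub_apply, h]; ring
  have j2 : Integrable fun y => y ^ 2 * h y := by
    have := ((i2.sub (i1.const_mul (2 * t))).add (i0.const_mul (t ^ 2))).comp_add_right t
    refine this.congr (Filter.Eventually.of_forall fun y => ?_)
    simp only [Pi.sub_apply, Pi.add_apply, h]; ring
  have n0 : ∫ y, h y = 1 := by rw [← m0]; exact integral_add_right_eq_self g t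
  have n1 : ∫ y, y * h y = -t := by
    have e : ∫ x, (x * g x - t * g x) = -t := by
      rw [integral_sub i1 (i0.const_mul t), integral_const_mul, m0, m1]; ring
    rw [← e, ← integral_add_right_eq_self (fun x => x * g x - t * g x) t]
    exact integral_congr_ae (Filter.Eventually.of_forall fun y => by simp only [h]; ring)
  have n2 : ∫ y, y ^ 2 * h y = 1 + t ^ 2 := by
    have i21 : Integrable fun x => x ^ 2 * g x - 2 * t * (x * g x) := i2.sub (i1.const_mul _)
    have e : ∫ x, (x ^ 2 * g x - 2 * t * (x * g x) + t ^ 2 * g x) = 1 + t ^ 2 := by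
      rw [integral_add i21 (i0.const_mul _), integral_sub i2 (i1.const_mul _),
        integral_const_mul, integral_const_mul, m0, m1, m2]; ring
    rw [← e, ← integral_add_right_eq_self
      (fun x => x ^ 2 * g x - 2 * t * (x * g x) + t ^ 2 * g x) t]
    exact integral_congr_ae (Filter.Eventually.of_forall fun y => by simp only [h]; ring)
  rw [integral_eq_integral_Ioi_add j0] at n0
  rw [integral_eq_integral_Ioi_add j1] at n1
  rw [integral_eq_integral_Ioi_add j2] at n2
  simp only [neg_mul, integral_neg, even_two, Even.neg_pow, ← sub_eq_add_neg] at n1 n2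
  have k0 : Integrable fun y => h (-y) := j0.comp_neg
  have k1 : Integrable fun y => y * h (-y) := by
    refine j1.comp_neg.neg.congr (Filter.Eventually.of_forall fun y => ?_)
    simp
  have bl := pow_integral_le_mul_moment (k := fun y => h (-y)) (c := M) (by linarith)
    (fun y _ => h0 _) (fun y _ => hM _) 1 k0.integrableOn (by simpa using k1.integrableOn)
  simp only [pow_one, Nat.cast_one, one_add_one_eq_two] at bl
  have br := pow_integral_le_mul_moment (k := h) (c := 1 / 1000) (by norm_num)
    (fun y _ => h0 _) (fun y hy => hcon _ (by have : 0 < y := hy; linarith)) 2 j0.integrableOn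
    j2.integrableOn
  have l2 : 0 ≤ ∫ y in Set.Ioi 0, y ^ 2 * h (-y) :=
    setIntegral_nonneg measurableSet_Ioi fun y _ => mul_nonneg (sq_nonneg y) (h0 _)
  have R0 : 0 ≤ ∫ y in Set.Ioi 0, h y := setIntegral_nonneg measurableSet_Ioi fun y _ => h0 _
  -- the integral of `(y - 10) ^ 2 * h y`: a second moment near `1` with a first moment of `0.18`
  -- needs more mass than `0.015`
  have cs : 0 ≤ (∫ y in Set.Ioi 0, y ^ 2 * h y) - 20 * (∫ y in Set.Ioi 0, y * h y) +
      100 * ∫ y in Set.Ioi 0, h y := by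
    have j21 : IntegrableOn (fun y => y ^ 2 * h y - 20 * (y * h y)) (Set.Ioi 0) :=
      j2.integrableOn.sub (j1.integrableOn.const_mul _)
    rw [← integral_const_mul, ← integral_const_mul, ← integral_sub j2.integrableOn
      (j1.integrableOn.const_mul _), ← integral_add j21 (j0.integrableOn.const_mul _)]
    refine setIntegral_nonneg measurableSet_Ioi fun y _ => ?_
    have e : y ^ 2 * h y - 20 * (y * h y) + 100 * h y = (y - 10) ^ 2 * h y := by ring
    rw [e]
    exact mul_nonneg (sq_nonneg _) (h0 _)
  norm_num at br
  set R := ∫ y in Set.Ioi 0, h y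
  set r₁ := ∫ y in Set.Ioi 0, y * h y
  set r₂ := ∫ y in Set.Ioi 0, y ^ 2 * h y
  set Q := ∫ y in Set.Ioi 0, h (-y)
  set l₁ := ∫ y in Set.Ioi 0, y * h (-y)
  have ht8 : t ≤ 1 / 8 := by nlinarith
  have hr₂ : r₂ ≤ 1016 / 1000 := by nlinarith
  have hR : R ≤ 15 / 1000 := by
    by_contra! hR
    have : (15 / 1000 : ℝ) ^ 3 < R ^ 3 := pow_lt_pow_left₀ hR (by norm_num) (by norm_num)
    norm_num at this
    linarith
  have hQ : 985 / 1000 ≤ Q := by linarith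
  have hMl : 97 / 100 ≤ 2 * (M * l₁) := by nlinarith
  have hMr : 36 / 100 ≤ M * r₁ := by
    have : r₁ = l₁ - t := by linarith
    rw [this]; nlinarith
  have hr₁ : 18 / 100 ≤ r₁ := by
    by_contra! hlt
    nlinarith
  linarith

/-- A bounded quasi-concave density with mean `0` and variance `1` exceeds `1 / 1000` on a whole
band around the mean. -/
theorem lt_of_abs_le_of_quasiconcave {g : ℝ → ℝ} {M t : ℝ} (h0 : ∀ x, 0 ≤ g x)
    (hM : ∀ x, g x ≤ M) (hM1 : 1 ≤ M) (hM2 : M ≤ 2)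
    (hq : ∀ x y z, x ≤ y → y ≤ z → min (g x) (g z) ≤ g y)
    (i0 : Integrable g) (i1 : Integrable fun x => x * g x)
    (i2 : Integrable fun x => x ^ 2 * g x) (m0 : ∫ x, g x = 1) (m1 : ∫ x, x * g x = 0)
    (m2 : ∫ x, x ^ 2 * g x = 1) (ht : 0 < t) (htM : t * M ≤ 1 / 8) {x : ℝ} (hx : |x| ≤ t) :
    1 / 1000 < g x := by
  obtain ⟨z, htz, hz⟩ := exists_large_value_right h0 hM hM1 hM2 i0 i1 i2 m0 m1 m2 ht htM
  have i1' : Integrable fun x => x * g (-x) := by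
    refine i1.comp_neg.neg.congr (Filter.Eventually.of_forall fun y => ?_)
    simp
  have i2' : Integrable fun x => x ^ 2 * g (-x) := by
    refine i2.comp_neg.congr (Filter.Eventually.of_forall fun y => ?_)
    simp
  have m1' : ∫ x, x * g (-x) = 0 := by
    have h := integral_neg_eq_self (fun x => x * g x) volume
    simp only [neg_mul, integral_neg] at h
    linarith
  have m2' : ∫ x, x ^ 2 * g (-x) = 1 := by
    have h := integral_neg_eq_self (fun x => x ^ 2 * g x) volume
    simp only [even_two, Even.neg_pow] at h
    linarith
  obtain ⟨y, hty, hy⟩ := exists_large_value_right (g := fun x => g (-x)) (fun x => h0 _)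
    (fun x => hM _) hM1 hM2 i0.comp_neg i1' i2'
    (by rw [← m0]; exact integral_neg_eq_self g volume) m1' m2' ht htM
  have hxt := abs_le.1 hx
  exact (lt_min hy hz).trans_le (hq (-y) x z (by linarith) (by linarith))

/-! ### The constants -/

theorem rpow_neg_half_le : (4 * Real.exp 1 * Real.pi) ^ (-(1 / 2) : ℝ) ≤ 1 / 5 := by
  have he := Real.exp_one_gt_d9
  have hpi := Real.pi_gt_three
  have h25 : (5 : ℝ) ^ (2 : ℝ) ≤ 4 * Real.exp 1 * Real.pi := by
    norm_num
    nlinarith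
  calc (4 * Real.exp 1 * Real.pi) ^ (-(1 / 2) : ℝ) ≤ ((5 : ℝ) ^ (2 : ℝ)) ^ (-(1 / 2) : ℝ) :=
        Real.rpow_le_rpow_of_nonpos (by positivity) h25 (by norm_num)
    _ = 1 / 5 := by
        rw [← Real.rpow_mul (by norm_num)]
        norm_num [Real.rpow_neg_one]

theorem one_div_three_mul_exp_three_le : 1 / (3 * Real.exp 3) ≤ 1 / 57 := by
  have he := Real.exp_one_gt_d9
  have h3 : Real.exp 3 = Real.exp 1 ^ 3 := by rw [← Real.exp_nat_mul]; norm_num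
  have h4 : (27 / 10 : ℝ) ^ 3 ≤ Real.exp 1 ^ 3 :=
    pow_le_pow_left₀ (by norm_num) (by linarith) 3
  rw [h3]
  exact one_div_le_one_div_of_le (by norm_num) (by norm_num at h4; linarith)

theorem exp_neg_one_div_three_le : Real.exp (-1) / 3 ≤ 123 / 1000 := by
  have he := Real.exp_one_gt_d9
  rw [Real.exp_neg, inv_eq_one_div, div_div, div_le_div_iff₀ (by positivity) (by norm_num)]
  linarith

theorem bandLowerOfGamma_zero_lt : bandLowerOfGamma 0 < 1 / 500 := by
  have h1 := rpow_neg_half_le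
  have h2 := one_div_three_mul_exp_three_le
  have h0 : (0 : ℝ) ≤ 1 / (3 * Real.exp 3) := by positivity
  simp only [bandLowerOfGamma, if_true]
  calc 2 * (1 / 4) * (4 * Real.exp 1 * Real.pi) ^ (-(1 / 2) : ℝ) * (1 / (3 * Real.exp 3))
      ≤ 2 * (1 / 4) * (1 / 5) * (1 / 57) := by gcongr
    _ < 1 / 500 := by norm_num

/-- With `a = 4 ^ u ≤ 2`, this is `2 - a ≤ 1 / a` raised to the power `1 / u`. -/
theorem two_sub_rpow_le {u : ℝ} (hu : 0 < u) (hu5 : u ≤ 1 / 5) :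
    0 ≤ (2 - (2 : ℝ) ^ (2 * u)) ^ (1 / u) ∧ (2 - (2 : ℝ) ^ (2 * u)) ^ (1 / u) ≤ 1 / 4 := by
  have ha : (0 : ℝ) < 2 ^ (2 * u) := by positivity
  have ha2 : (2 : ℝ) ^ (2 * u) ≤ 2 := by
    calc (2 : ℝ) ^ (2 * u) ≤ 2 ^ (1 : ℝ) :=
          Real.rpow_le_rpow_of_exponent_le (by norm_num) (by linarith)
      _ = 2 := Real.rpow_one 2
  have h1 : 2 - (2 : ℝ) ^ (2 * u) ≤ (2 : ℝ) ^ (-(2 * u)) := by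
    rw [Real.rpow_neg (by norm_num), inv_eq_one_div, le_div_iff₀ ha]
    nlinarith [sq_nonneg ((2 : ℝ) ^ (2 * u) - 1)]
  refine ⟨Real.rpow_nonneg (by linarith) _, ?_⟩
  calc _ ≤ ((2 : ℝ) ^ (-(2 * u))) ^ (1 / u) :=
        Real.rpow_le_rpow (by linarith) h1 (by positivity)
    _ = 1 / 4 := by
        rw [← Real.rpow_mul (by norm_num)]
        have : -(2 * u) * (1 / u) = ((-2 : ℤ) : ℝ) := by field_simp; norm_num
        rw [this, Real.rpow_intCast]
        norm_num

theorem ratio_le_exp {u : ℝ} (hu5 : u ≤ 1 / 5) :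
    (1 - 2 * u) / (1 - u) ≤ Real.exp (-(u / (1 - u))) := by
  have h1 : 1 - u ≠ 0 := by linarith
  have e : (1 - 2 * u) / (1 - u) = -(u / (1 - u)) + 1 := by field_simp; ring
  rw [e]
  exact Real.add_one_le_exp _

/-- With `z = Y ^ (-u) ≥ 1 / 2`, this is `2 z - 1 ≤ z ^ 2` raised to the power `1 / u`, together
with `Y ^ 2 ≥ 3 e ^ 3`. -/
theorem two_mul_rpow_sub_one_le {u : ℝ} (hu : 0 < u) (hu5 : u ≤ 1 / 5) :
    (2 * ((1 - u) / (1 - 3 * u) * √3 *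
      ((1 - 2 * u) / (1 - u)) ^ (-((3 - 3 * u) / (2 * u)))) ^ (-u) - 1) ^ (1 / u) ≤
      1 / (3 * Real.exp 3) := by
  have h1u : 0 < 1 - u := by linarith
  have h2u : 0 < 1 - 2 * u := by linarith
  have h3u : 0 < 1 - 3 * u := by linarith
  have h33u : 0 < 3 - 3 * u := by linarith
  set B := (1 - u) / (1 - 3 * u) * √3 with hB
  set D := (1 - 2 * u) / (1 - u) with hD
  set Y := B * D ^ (-((3 - 3 * u) / (2 * u))) with hY
  have hD0 : 0 < D := by positivity
  have hB0 : 0 < B := by positivity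
  have hY0 : 0 < Y := by positivity
  have hratio : 1 ≤ (1 - u) / (1 - 3 * u) := by rw [le_div_iff₀ h3u]; linarith
  have hratio2 : (1 - u) / (1 - 3 * u) ≤ 2 := by rw [div_le_iff₀ h3u]; linarith
  have hBlow : √3 ≤ B := le_mul_of_one_le_left (by positivity) hratio
  have hs3 : √3 ^ 2 = (3 : ℝ) := Real.sq_sqrt (by norm_num)
  have hY2 : 3 * Real.exp 3 ≤ Y ^ 2 := by
    have hpow : Real.exp (3 / 2) ≤ D ^ (-((3 - 3 * u) / (2 * u))) := by
      have h := Real.rpow_le_rpow_of_nonpos (z := -((3 - 3 * u) / (2 * u))) hD0 (ratio_le_exp hu5)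
        (neg_nonpos.2 (by positivity))
      rw [← Real.exp_mul] at h
      have e : -(u / (1 - u)) * -((3 - 3 * u) / (2 * u)) = 3 / 2 := by
        have : 3 - 3 * u = 3 * (1 - u) := by ring
        rw [this]; field_simp
      rwa [e] at h
    have hYl : √3 * Real.exp (3 / 2) ≤ Y := mul_le_mul hBlow hpow (by positivity) hB0.le
    calc 3 * Real.exp 3 = (√3 * Real.exp (3 / 2)) ^ 2 := by
          rw [mul_pow, hs3, ← Real.exp_nat_mul]; norm_num
      _ ≤ Y ^ 2 := pow_le_pow_left₀ (by positivity) hYl 2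
  have hYu : Y ^ u ≤ 2 := by
    have e : Y ^ u = B ^ u * (D⁻¹) ^ ((3 - 3 * u) / 2) := by
      rw [hY, Real.mul_rpow hB0.le (by positivity), ← Real.rpow_mul hD0.le, Real.inv_rpow hD0.le,
        ← Real.rpow_neg hD0.le]
      congr 2
      field_simp
    have hsq : √3 ≤ 174 / 100 := by rw [Real.sqrt_le_left (by norm_num)]; norm_num
    have hB2 : B ≤ 348 / 100 := by
      calc B ≤ 2 * (174 / 100) := mul_le_mul hratio2 hsq (by positivity) (by norm_num)
        _ = 348 / 100 := by norm_num
    have hB1 : 1 ≤ B := le_trans (by rw [Real.le_sqrt] <;> norm_num) hBlow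
    have f1 : B ^ u ≤ 1285 / 1000 := by
      calc B ^ u ≤ B ^ (1 / 5 : ℝ) := Real.rpow_le_rpow_of_exponent_le hB1 hu5
        _ ≤ ((1285 / 1000 : ℝ) ^ (5 : ℝ)) ^ (1 / 5 : ℝ) := by
            refine Real.rpow_le_rpow hB0.le (hB2.trans ?_) (by norm_num)
            norm_num
        _ = 1285 / 1000 := by rw [← Real.rpow_mul (by norm_num)]; norm_num
    have hDi : D⁻¹ ≤ 4 / 3 := by
      rw [hD, inv_div, div_le_div_iff₀ h2u (by norm_num)]; linarith
    have f2 : (D⁻¹) ^ ((3 - 3 * u) / 2) ≤ 154 / 100 := by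
      calc (D⁻¹) ^ ((3 - 3 * u) / 2) ≤ (4 / 3 : ℝ) ^ ((3 - 3 * u) / 2) :=
            Real.rpow_le_rpow (by positivity) hDi (by positivity)
        _ ≤ (4 / 3 : ℝ) ^ ((3 : ℝ) * (1 / 2)) :=
            Real.rpow_le_rpow_of_exponent_le (by norm_num) (by linarith)
        _ = ((4 / 3 : ℝ) ^ (3 : ℝ)) ^ (1 / 2 : ℝ) := Real.rpow_mul (by norm_num) _ _
        _ ≤ ((154 / 100 : ℝ) ^ (2 : ℝ)) ^ (1 / 2 : ℝ) :=
            Real.rpow_le_rpow (by positivity) (by norm_num) (by norm_num)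
        _ = 154 / 100 := by rw [← Real.rpow_mul (by norm_num)]; norm_num
    rw [e]
    calc B ^ u * (D⁻¹) ^ ((3 - 3 * u) / 2) ≤ 1285 / 1000 * (154 / 100) := by gcongr
      _ ≤ 2 := by norm_num
  have hz0 : 0 < Y ^ (-u) := by positivity
  have hz : 1 / 2 ≤ Y ^ (-u) := by
    rw [Real.rpow_neg hY0.le, inv_eq_one_div]
    exact one_div_le_one_div_of_le (by positivity) hYu
  calc (2 * Y ^ (-u) - 1) ^ (1 / u) ≤ ((Y ^ (-u)) ^ (2 : ℝ)) ^ (1 / u) := by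
        refine Real.rpow_le_rpow (by linarith) ?_ (by positivity)
        rw [Real.rpow_two]
        nlinarith [sq_nonneg (Y ^ (-u) - 1)]
    _ = (Y ^ 2)⁻¹ := by
        rw [← Real.rpow_mul hY0.le, ← Real.rpow_mul hY0.le]
        have : -u * 2 * (1 / u) = ((-2 : ℤ) : ℝ) := by field_simp; norm_num
        rw [this, Real.rpow_intCast]
        rfl
    _ ≤ 1 / (3 * Real.exp 3) := by
        rw [inv_eq_one_div]
        exact one_div_le_one_div_of_le (by positivity) hY2

theorem bandLowerOfGamma_neg_lt {u : ℝ} (hu : 0 < u) (hu5 : u ≤ 1 / 5) :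
    bandLowerOfGamma (-u) < 1 / 500 := by
  have h1 := rpow_neg_half_le
  have h2 := one_div_three_mul_exp_three_le
  obtain ⟨h3, h3'⟩ := two_sub_rpow_le hu hu5
  have h4 := two_mul_rpow_sub_one_le hu hu5
  have e1 : -(2 * -u) = 2 * u := by ring
  have e2 : -(1 / -u) = 1 / u := by rw [div_neg, neg_neg]
  have e3 : (3 + 3 * -u) / (2 * -u) = -((3 - 3 * u) / (2 * u)) := by
    rw [mul_neg, mul_neg, div_neg, ← sub_eq_add_neg]
  simp only [bandLowerOfGamma, neg_eq_zero, hu.ne', if_false, e1, e2, e3]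
  simp only [mul_neg, ← sub_eq_add_neg]
  calc _ ≤ 2 * (2 - (2 : ℝ) ^ (2 * u)) ^ (1 / u) *
        (4 * Real.exp 1 * Real.pi) ^ (-(1 / 2) : ℝ) * (1 / 57) :=
        mul_le_mul_of_nonneg_left (h4.trans h2) (by positivity)
    _ ≤ 2 * (1 / 4) * (1 / 5) * (1 / 57) := by gcongr
    _ < 1 / 500 := by norm_num

theorem bandRadiusOfGamma_neg_mul_le {u : ℝ} (hu : 0 < u) (hu5 : u ≤ 1 / 5) :
    bandRadiusOfGamma (-u) * ((1 - u) / (1 - 3 * u)) ≤ 1 / 8 := by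
  have h1u : 0 < 1 - u := by linarith
  have h2u : 0 < 1 - 2 * u := by linarith
  have h3u : 0 < 1 - 3 * u := by linarith
  have e2 : -((1 - u) / -u) = (1 - u) / u := by rw [div_neg, neg_neg]
  simp only [bandRadiusOfGamma, neg_eq_zero, hu.ne', if_false, mul_neg, ← sub_eq_add_neg, e2]
  have h : ((1 - 2 * u) / (1 - u)) ^ ((1 - u) / u) ≤ Real.exp (-1) := by
    calc _ ≤ Real.exp (-(u / (1 - u))) ^ ((1 - u) / u) :=
          Real.rpow_le_rpow (by positivity) (ratio_le_exp hu5) (by positivity)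
      _ = Real.exp (-1) := by
          rw [← Real.exp_mul]; congr 1; field_simp
  have e3 : ((1 - 2 * u) / (1 - u)) ^ ((1 - u) / u) * ((1 - 3 * u) / (3 - 3 * u)) *
      ((1 - u) / (1 - 3 * u)) = ((1 - 2 * u) / (1 - u)) ^ ((1 - u) / u) / 3 := by
    have : 3 - 3 * u = 3 * (1 - u) := by ring
    rw [this, mul_assoc, div_mul_div_comm, mul_comm 3 (1 - u), mul_comm (1 - 3 * u), mul_assoc,
      mul_comm 3 (1 - 3 * u), ← mul_assoc, div_mul_eq_div_div, div_self (by positivity),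
      mul_one_div]
  rw [e3]
  linarith [exp_neg_one_div_three_le]

/-! ### Linear marginals of isotropic distributions -/

theorem IsIsotropic.moments_inner {n : ℕ} {μ : Measure (EuclideanSpace ℝ (Fin n))}
    [IsProbabilityMeasure μ] (h : IsIsotropic μ) {w : EuclideanSpace ℝ (Fin n)} (hw : ‖w‖ = 1) :
    Integrable (fun x => inner ℝ w x) μ ∧ Integrable (fun x => inner ℝ w x ^ 2) μ ∧
      ∫ x, inner ℝ w x ∂μ = 0 ∧ ∫ x, inner ℝ w x ^ 2 ∂μ = 1 := by
  obtain ⟨hL, hmean, hcov⟩ := h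
  have hi : Integrable (fun x : EuclideanSpace ℝ (Fin n) => x) μ := hL.integrable (by norm_num)
  have hproj : ∀ i, MemLp (fun x : EuclideanSpace ℝ (Fin n) => x i) 2 μ := fun i =>
    (EuclideanSpace.proj (𝕜 := ℝ) i).comp_memLp' hL
  have hm : ∀ i, ∫ x : EuclideanSpace ℝ (Fin n), x i ∂μ = 0 := by
    intro i
    have := (EuclideanSpace.proj (𝕜 := ℝ) i).integral_comp_comm hi
    rw [hmean, map_zero] at this
    exact this
  have hprod : ∀ i j, ∫ x : EuclideanSpace ℝ (Fin n), x i * x j ∂μ =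
      (1 : Matrix (Fin n) (Fin n) ℝ) i j := by
    intro i j
    rw [← hcov i j, covariance_eq_sub (hproj i) (hproj j), hm i, zero_mul, sub_zero]
    rfl
  have hij : ∀ i j, Integrable (fun x : EuclideanSpace ℝ (Fin n) => w i * w j * (x i * x j)) μ :=
    fun i j => ((hproj i).integrable_mul (hproj j)).const_mul _
  have hin : MemLp (fun x => inner ℝ w x) 2 μ := hL.const_inner w
  refine ⟨hin.integrable (by norm_num), hin.integrable_sq, ?_, ?_⟩
  · rw [integral_inner hi, hmean, inner_zero_right]
  · have e : ∀ x : EuclideanSpace ℝ (Fin n),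
        inner ℝ w x ^ 2 = ∑ i, ∑ j, w i * w j * (x i * x j) := by
      intro x
      rw [PiLp.inner_apply, sq, Finset.sum_mul_sum]
      refine Finset.sum_congr rfl fun i _ => Finset.sum_congr rfl fun j _ => ?_
      simp only [RCLike.inner_apply, conj_trivial]
      ring
    simp only [e]
    rw [integral_finsetSum _ fun i _ => integrable_finsetSum _ fun j _ => hij i j]
    have e2 : ∀ i, ∫ x : EuclideanSpace ℝ (Fin n), ∑ j, w i * w j * (x i * x j) ∂μ = w i ^ 2 := by
      intro i
      rw [integral_finsetSum _ fun j _ => hij i j]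
      simp only [integral_const_mul, hprod, Matrix.one_apply]
      simp [sq]
    simp only [e2]
    have := EuclideanSpace.real_norm_sq_eq w
    rw [hw] at this
    linarith

/-- Linear coordinates on `ℝ × ℝᵏ` for Euclidean space of dimension `k + 1` that preserve volume
and in which a given unit vector is the first coordinate. -/
theorem exists_measurePreserving_coordinates {k : ℕ} {w : EuclideanSpace ℝ (Fin (k + 1))}
    (hw : ‖w‖ = 1) :
    ∃ T : ℝ × (Fin k → ℝ) ≃ᵐ EuclideanSpace ℝ (Fin (k + 1)), MeasurePreserving T ∧
      (∀ p q : ℝ × (Fin k → ℝ), ∀ l : ℝ, T (l • p + (1 - l) • q) = l • T p + (1 - l) • T q) ∧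
      ∀ p, inner ℝ w (T p) = p.1 := by
  have hon : Orthonormal ℝ (({0} : Set (Fin (k + 1))).domRestrict fun _ => w) := by
    rw [orthonormal_iff_ite]
    rintro ⟨i, hi⟩ ⟨j, hj⟩
    obtain rfl : i = 0 := hi
    obtain rfl : j = 0 := hj
    simp [hw]
  obtain ⟨b, hb⟩ := hon.exists_orthonormalBasis_extension_of_card_eq (by simp)
  have hb0 : b 0 = w := hb 0 rfl
  let e := (MeasurableEquiv.piFinSuccAbove (fun _ : Fin (k + 1) => ℝ) 0).symm
  let T := (e.trans (MeasurableEquiv.toLp 2 (Fin (k + 1) → ℝ))).trans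
    b.repr.symm.toHomeomorph.toMeasurableEquiv
  have hT : ∀ p, T p = b.repr.symm (WithLp.toLp 2 (e p)) := fun p => rfl
  refine ⟨T, ?_, fun p q l => ?_, fun p => ?_⟩
  · exact (b.measurePreserving_repr_symm.comp (PiLp.volume_preserving_toLp _)).comp
      (volume_preserving_piFinSuccAbove (fun _ : Fin (k + 1) => ℝ) 0).symm
  · rw [hT, hT, hT, ← map_smul, ← map_smul, ← map_add]
    congr 1
    ext i
    refine Fin.cases ?_ (fun i => ?_) i <;> rfl
  · rw [hT, ← hb0, ← b.repr_apply_apply, LinearIsometryEquiv.apply_symm_apply]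
    rfl

theorem MeasureTheory.MeasurePreserving.map_withDensity_comp {α β : Type*} [MeasurableSpace α]
    [MeasurableSpace β] {μ : Measure α} {ν : Measure β} {T : α ≃ᵐ β} (hT : MeasurePreserving T μ ν)
    (f : β → ENNReal) : (μ.withDensity fun a => f (T a)).map T = ν.withDensity f := by
  ext A hA
  rw [Measure.map_apply T.measurable hA, withDensity_apply _ (T.measurable hA),
    withDensity_apply _ hA]
  exact hT.setLIntegral_comp_preimage_emb T.measurableEmbedding f A

section WithDensity

variable {α : Type*} [MeasurableSpace α] {μ : Measure α} {f : α → ℝ}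

theorem integrable_withDensity_ofReal_iff (hf : Measurable f) (h0 : ∀ x, 0 ≤ f x) {φ : α → ℝ} :
    Integrable φ (μ.withDensity fun x => ENNReal.ofReal (f x)) ↔
      Integrable (fun x => φ x * f x) μ := by
  rw [integrable_withDensity_iff_integrable_smul' hf.ennreal_ofReal
    (Filter.Eventually.of_forall fun x => ENNReal.ofReal_lt_top)]
  simp only [ENNReal.toReal_ofReal (h0 _), smul_eq_mul, mul_comm]

theorem integral_withDensity_ofReal (hf : Measurable f) (h0 : ∀ x, 0 ≤ f x) (φ : α → ℝ) :
    ∫ x, φ x ∂(μ.withDensity fun x => ENNReal.ofReal (f x)) = ∫ x, φ x * f x ∂μ := by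
  rw [integral_withDensity_eq_integral_toReal_smul hf.ennreal_ofReal
    (Filter.Eventually.of_forall fun x => ENNReal.ofReal_lt_top)]
  simp only [ENNReal.toReal_ofReal (h0 _), smul_eq_mul, mul_comm]

end WithDensity

/-- The distribution of `⟨w, x⟩` under an isotropic `s`-concave distribution has a bounded
quasi-concave density. -/
theorem exists_density_map_inner {k : ℕ} {s u : ℝ} (hs : s < 0)
    (hs3 : 0 < 1 + ((k : ℝ) + 3) * s) (hu : u = -(s / (1 + k * s)))
    {μ : Measure (EuclideanSpace ℝ (Fin (k + 1)))} [IsProbabilityMeasure μ]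
    {f : EuclideanSpace ℝ (Fin (k + 1)) → ℝ} (hf : Measurable f) (hc : SConcave s f)
    (hμ : μ = volume.withDensity fun x => ENNReal.ofReal (f x)) (hiso : IsIsotropic μ)
    {w : EuclideanSpace ℝ (Fin (k + 1))} (hw : ‖w‖ = 1) :
    ∃ g : ℝ → ℝ, Measurable g ∧ (∀ x, 0 ≤ g x) ∧ (∀ x, g x ≤ (1 - u) / (1 - 3 * u)) ∧
      (∀ x y z, x ≤ y → y ≤ z → min (g x) (g z) ≤ g y) ∧
      μ.map (fun x => inner ℝ w x) = volume.withDensity fun x => ENNReal.ofReal (g x) := by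
  obtain ⟨T, hT, hlin, hfst⟩ := exists_measurePreserving_coordinates hw
  obtain ⟨hi1, hi2, hm1, hm2⟩ := hiso.moments_inner hw
  obtain ⟨h0, hc⟩ := hc
  have hmeas : Measurable fun x : EuclideanSpace ℝ (Fin (k + 1)) => inner ℝ w x := by fun_prop
  have hint : ∀ φ : ℝ → ℝ, Integrable (fun x => φ (inner ℝ w x)) μ →
      Integrable fun p : ℝ × (Fin k → ℝ) => φ p.1 * f (T p) := by
    intro φ hφ
    rw [hμ, integrable_withDensity_ofReal_iff hf h0] at hφ
    have := (hT.integrable_comp_emb T.measurableEmbedding).2 hφ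
    simpa only [Function.comp_def, hfst] using this
  have hval : ∀ φ : ℝ → ℝ, ∫ p : ℝ × (Fin k → ℝ), φ p.1 * f (T p) =
      ∫ x, φ (inner ℝ w x) ∂μ := by
    intro φ
    rw [hμ, integral_withDensity_ofReal hf h0, ← hT.integral_comp T.measurableEmbedding]
    simp only [hfst]
  have j0 := hint (fun _ => 1) (integrable_const 1)
  have v0 := hval fun _ => 1
  simp only [one_mul, integral_const, probReal_univ, smul_eq_mul, mul_one] at j0 v0
  obtain ⟨g, hg, hg0, hgC, hgq, hmap⟩ := exists_bounded_marginal_density hs hs3 hu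
    (F := fun p => f (T p)) (hf.comp T.measurable) (fun p => h0 _)
    (fun x y l hl hl1 => by rw [hlin]; exact hc _ _ l hl hl1) j0 (hint (fun t => t) hi1)
    (hint (fun t => t ^ 2) hi2) v0 ((hval fun t => t).trans hm1)
    ((hval fun t => t ^ 2).trans hm2)
  refine ⟨g, hg, hg0, hgC, hgq, ?_⟩
  rw [← hmap, hμ, ← hT.map_withDensity_comp, Measure.map_map hmeas T.measurable]
  simp only [Function.comp_def, hfst]

/-! ### Band probabilities -/

/-- The two-sided band estimate for negative `s`, with a common lower constant. -/
theorem band_bounds_of_neg {k : ℕ} {s u : ℝ} (hs : s < 0)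
    (hs3 : 0 < 1 + ((k : ℝ) + 3) * s) (hu : u = -(s / (1 + k * s)))
    {μ : Measure (EuclideanSpace ℝ (Fin (k + 1)))} [IsProbabilityMeasure μ]
    {f : EuclideanSpace ℝ (Fin (k + 1)) → ℝ} (hf : Measurable f) (hc : SConcave s f)
    (hμ : μ = volume.withDensity fun x => ENNReal.ofReal (f x)) (hiso : IsIsotropic μ)
    {w : EuclideanSpace ℝ (Fin (k + 1))} (hw : ‖w‖ = 1) :
    (∀ t, 0 ≤ t → μ.real {x | |inner ℝ w x| ≤ t} ≤ 2 * ((1 - u) / (1 - 3 * u)) * t) ∧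
    ((1 - u) / (1 - 3 * u) ≤ 2 → ∀ t, 0 < t → t * ((1 - u) / (1 - 3 * u)) ≤ 1 / 8 →
      1 / 500 * t ≤ μ.real {x | |inner ℝ w x| ≤ t}) := by
  obtain ⟨g, hg, hg0, hgC, hgq, hmap⟩ := exists_density_map_inner hs hs3 hu hf hc hμ hiso hw
  obtain ⟨hi1, hi2, hm1, hm2⟩ := hiso.moments_inner hw
  have hmeas : Measurable fun x : EuclideanSpace ℝ (Fin (k + 1)) => inner ℝ w x := by fun_prop
  have hint : ∀ φ : ℝ → ℝ, Measurable φ → Integrable (fun x => φ (inner ℝ w x)) μ →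
      Integrable fun x : ℝ => φ x * g x := by
    intro φ hφ hi
    rw [← integrable_withDensity_ofReal_iff hg hg0, ← hmap,
      integrable_map_measure hφ.aestronglyMeasurable hmeas.aemeasurable]
    exact hi
  have hval : ∀ φ : ℝ → ℝ, Measurable φ → ∫ x, φ x * g x = ∫ x, φ (inner ℝ w x) ∂μ := by
    intro φ hφ
    rw [← integral_withDensity_ofReal hg hg0, ← hmap,
      integral_map hmeas.aemeasurable hφ.aestronglyMeasurable]
  have j0 := hint (fun _ => 1) measurable_const (integrable_const 1)
  have v0 := hval (fun _ => 1) measurable_const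
  simp only [one_mul, integral_const, probReal_univ, smul_eq_mul, mul_one] at j0 v0
  have hprob : ∀ t : ℝ, μ.real {x | |inner ℝ w x| ≤ t} = ∫ x in Set.Icc (-t) t, g x := by
    intro t
    have e : {x | |inner ℝ w x| ≤ t} = (fun x => inner ℝ w x) ⁻¹' Set.Icc (-t) t := by
      ext x; simp [abs_le]
    rw [e, ← map_measureReal_apply hmeas measurableSet_Icc, hmap, measureReal_def,
      withDensity_apply _ measurableSet_Icc, ← ofReal_integral_eq_lintegral_ofReal j0.integrableOn
      (Filter.Eventually.of_forall hg0), ENNReal.toReal_ofReal (integral_nonneg hg0)]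
  have hconst : ∀ c t : ℝ, 0 ≤ t → ∫ _ in Set.Icc (-t) t, c = 2 * c * t := by
    intro c t ht
    rw [setIntegral_const, Real.volume_real_Icc_of_le (by linarith), smul_eq_mul]
    ring
  refine ⟨fun t ht => ?_, fun hC2 t ht htC => ?_⟩
  · rw [hprob, ← hconst _ _ ht]
    exact integral_mono j0.integrableOn (integrable_const _) hgC
  · have hk0 : (0 : ℝ) ≤ k := Nat.cast_nonneg k
    have hk1 : 0 < 1 + (k : ℝ) * s := by nlinarith
    have hu0 : 0 < u := by rw [hu]; exact neg_pos.2 (div_neg_of_neg_of_pos hs hk1)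
    have hu3 : 0 < 1 - 3 * u := by
      have : u < 1 / 3 := by rw [hu, ← neg_div, div_lt_iff₀ hk1]; linarith
      linarith
    have hC1 : 1 ≤ (1 - u) / (1 - 3 * u) := by rw [le_div_iff₀ hu3]; linarith
    have e : 1 / 500 * t = 2 * (1 / 1000) * t := by ring
    rw [hprob, e, ← hconst _ _ ht.le]
    refine setIntegral_mono_on (integrable_const _) j0.integrableOn measurableSet_Icc
      fun x hx => ?_
    exact (lt_of_abs_le_of_quasiconcave hg0 hgC hC1 hC2 hgq j0
      (hint (fun t => t) measurable_id hi1) (hint (fun t => t ^ 2) (measurable_id.pow_const 2) hi2)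
      v0 ((hval (fun t => t) measurable_id).trans hm1)
      ((hval (fun t => t ^ 2) (measurable_id.pow_const 2)).trans hm2) ht htC
      (abs_le.2 hx)).le

theorem SConcave.of_zero {n : ℕ} {s : ℝ} (hs : s < 0) {f : EuclideanSpace ℝ (Fin n) → ℝ}
    (hf : SConcave 0 f) : SConcave s f :=
  ⟨hf.1, fun x y l hl hl1 =>
    (powerMean_le_powerMean_zero hs hl hl1 (hf.1 x) (hf.1 y)).trans (hf.2 x y l hl hl1)⟩

/-- The bound on the peak of the marginal, in terms of the exponent `s` of the joint density. -/
theorem peak_constant_eq {k s : ℝ} (hk : 0 < 1 + k * s) :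
    (1 - -(s / (1 + k * s))) / (1 - 3 * -(s / (1 + k * s))) =
      (1 + (k + 1) * s) / (1 + (k + 3) * s) := by
  have h := div_mul_cancel₀ s hk.ne'
  have e1 : 1 - -(s / (1 + k * s)) = (1 + (k + 1) * s) / (1 + k * s) := by
    rw [eq_div_iff hk.ne']; linear_combination h
  have e2 : 1 - 3 * -(s / (1 + k * s)) = (1 + (k + 3) * s) / (1 + k * s) := by
    rw [eq_div_iff hk.ne']; linear_combination 3 * h
  rw [e1, e2, div_div_div_cancel_right₀ hk.ne']

/-- A log-concave function is `s`-concave for every negative `s`; the constants for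
`s = -δ / (k + 3)` are at most `1 / (1 - δ)`. -/
theorem band_bounds_of_logconcave {k : ℕ} {δ : ℝ} (hδ : 0 < δ) (hδ1 : δ < 1)
    {μ : Measure (EuclideanSpace ℝ (Fin (k + 1)))} [IsProbabilityMeasure μ]
    {f : EuclideanSpace ℝ (Fin (k + 1)) → ℝ} (hf : Measurable f) (hc : SConcave 0 f)
    (hμ : μ = volume.withDensity fun x => ENNReal.ofReal (f x)) (hiso : IsIsotropic μ)
    {w : EuclideanSpace ℝ (Fin (k + 1))} (hw : ‖w‖ = 1) :
    (∀ t, 0 ≤ t → μ.real {x | |inner ℝ w x| ≤ t} ≤ 2 * (1 / (1 - δ)) * t) ∧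
    (1 / (1 - δ) ≤ 2 → ∀ t, 0 < t → t * (1 / (1 - δ)) ≤ 1 / 8 →
      1 / 500 * t ≤ μ.real {x | |inner ℝ w x| ≤ t}) := by
  have hk0 : (0 : ℝ) ≤ k := Nat.cast_nonneg k
  have hk3 : (0 : ℝ) < (k : ℝ) + 3 := by positivity
  set s := -(δ / ((k : ℝ) + 3)) with hsdef
  have hs : s < 0 := neg_lt_zero.2 (by positivity)
  have hδs : ((k : ℝ) + 3) * s = -δ := by rw [hsdef]; field_simp
  have h1δ : 0 < 1 - δ := by linarith
  have hk1 : 0 < 1 + (k : ℝ) * s := by nlinarith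
  have hC : (1 - -(s / (1 + k * s))) / (1 - 3 * -(s / (1 + k * s))) ≤ 1 / (1 - δ) := by
    have e : 1 + ((k : ℝ) + 3) * s = 1 - δ := by rw [hδs]; ring
    rw [peak_constant_eq hk1, e]
    gcongr
    nlinarith
  obtain ⟨h1, h2⟩ := band_bounds_of_neg hs (by rw [hδs]; linarith) rfl hf (hc.of_zero hs) hμ
    hiso hw
  refine ⟨fun t ht => (h1 t ht).trans (by gcongr), fun hle t ht htC => ?_⟩
  exact h2 (hC.trans hle) t ht ((mul_le_mul_of_nonneg_left hC ht.le).trans htC)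

theorem mainTheorem5 (n : ℕ) (s : ℝ) (hs : -(1 / (2 * (n : ℝ) + 3)) ≤ s) (hs0 : s ≤ 0)
    (μ : Measure (EuclideanSpace ℝ (Fin n))) [IsProbabilityMeasure μ]
    (hconc : IsSConcaveDistribution s μ) (hiso : IsIsotropic μ)
    (w : EuclideanSpace ℝ (Fin n)) (hw : ‖w‖ = 1) :
    (∀ t : ℝ, 0 ≤ t → μ.real {x | |inner ℝ w x| ≤ t} ≤ bandUpper s n * t) ∧
    (∀ t : ℝ, 0 < t → t ≤ bandRadius s n →
      bandLower s n * t < μ.real {x | |inner ℝ w x| ≤ t}) := by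
  obtain ⟨f, hf, hc, hμ⟩ := hconc
  rcases n with _ | k
  · -- in dimension `0` there is no unit vector
    rw [Subsingleton.elim w 0, norm_zero] at hw
    exact absurd hw zero_ne_one
  have hk0 : (0 : ℝ) ≤ k := Nat.cast_nonneg k
  rcases hs0.eq_or_lt with rfl | hs0
  · have hg : bandGamma 0 (k + 1) = 0 := by simp [bandGamma]
    refine ⟨fun t ht => ?_, fun t ht htd => ?_⟩
    · have hlim : Filter.Tendsto (fun δ : ℝ => 2 * (1 / (1 - δ)) * t) (nhdsWithin 0 (Set.Ioi 0))
          (nhds (bandUpper 0 (k + 1) * t)) := by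
        have hcont : ContinuousAt (fun δ : ℝ => 2 * (1 / (1 - δ)) * t) 0 := by
          have : (1 : ℝ) - 0 ≠ 0 := by norm_num
          fun_prop (disch := exact this)
        have e : bandUpper 0 (k + 1) * t = 2 * (1 / (1 - 0)) * t := by
          simp [bandUpper]
        rw [e]
        exact hcont.tendsto.mono_left nhdsWithin_le_nhds
      refine ge_of_tendsto hlim ?_
      filter_upwards [Ioo_mem_nhdsGT (show (0 : ℝ) < 1 by norm_num)] with δ hδ
      exact (band_bounds_of_logconcave hδ.1 hδ.2 hf hc hμ hiso hw).1 t ht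
    · have hd : t ≤ 123 / 1000 := by
        refine htd.trans ?_
        simp only [bandRadius, hg, bandRadiusOfGamma, if_true]
        exact exp_neg_one_div_three_le
      -- `123 / 1000 / (1 - δ) ≤ 1 / 8` for this `δ`
      have h := (band_bounds_of_logconcave (δ := 1 / 100) (by norm_num) (by norm_num) hf hc hμ hiso
        hw).2 (by norm_num) t ht (by norm_num; linarith)
      refine lt_of_lt_of_le ?_ h
      rw [bandLower, hg]
      exact mul_lt_mul_of_pos_right bandLowerOfGamma_zero_lt ht
  · push_cast at hs
    have hden : 0 < 2 * ((k : ℝ) + 1) + 3 := by positivity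
    have hs' : -1 ≤ (2 * (k : ℝ) + 5) * s := by
      rw [← neg_div, div_le_iff₀ hden] at hs
      linarith
    have hs3 : 0 < 1 + ((k : ℝ) + 3) * s := by nlinarith
    have hk1 : 0 < 1 + (k : ℝ) * s := by nlinarith
    obtain ⟨u, hu⟩ : ∃ u, u = -(s / (1 + k * s)) := ⟨_, rfl⟩
    have hg : bandGamma s (k + 1) = -u := by
      rw [hu, neg_neg, bandGamma]; push_cast; rw [add_sub_cancel_right]
    have hu0 : 0 < u := by rw [hu]; exact neg_pos.2 (div_neg_of_neg_of_pos hs0 hk1)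
    have hu5 : u ≤ 1 / 5 := by
      rw [hu, ← neg_div, div_le_iff₀ hk1]
      nlinarith
    have hC : 2 * ((1 - u) / (1 - 3 * u)) = bandUpper s (k + 1) := by
      rw [hu, peak_constant_eq hk1, bandUpper, mul_div_assoc]
      push_cast
      ring_nf
    have hC2 : (1 - u) / (1 - 3 * u) ≤ 2 := by
      rw [div_le_iff₀ (by linarith)]; linarith
    have hC0 : 0 ≤ (1 - u) / (1 - 3 * u) := div_nonneg (by linarith) (by linarith)
    obtain ⟨h1, h2⟩ := band_bounds_of_neg hs0 hs3 hu hf hc hμ hiso hw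
    refine ⟨fun t ht => hC ▸ h1 t ht, fun t ht htd => ?_⟩
    rw [bandRadius, hg] at htd
    refine lt_of_lt_of_le ?_ (h2 hC2 t ht ((mul_le_mul_of_nonneg_right htd hC0).trans
      (bandRadiusOfGamma_neg_mul_le hu0 hu5)))
    rw [bandLower, hg]
    exact mul_lt_mul_of_pos_right (bandLowerOfGamma_neg_lt hu0 hu5) ht
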